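/- For every $z\in\mathbb C^k$ let $\Gamma_z$ be a closed cone of $(1,0)$-vectors at $z$ that contains non-zero vectors, and assume that $\Gamma:=\bigcup_{z\in\mathbb C^k}\Gamma_z$ is closed (in the bundle of $(1,0)$-vectors, identified with $\mathbb C^k\times\mathbb C^k$). Let $$\mathcal P_\Gamma:=\{u\in\mathcal C^2(\mathbb C^k,\mathbb R):\ \langle i\partial\overline\partial u(z),\,i\xi_z\wedge\bar\xi_z\rangle\ge 0\ \text{ for every } z\in\mathbb C^k \text{ and every } \xi_z\in\Gamma_z\}.$$ A current $T$ of bidimension $(1,1)$ on $\mathbb C^k$ is called positive and $\Gamma$-directed if $T\ge 0$ and $T\wedge i\partial\overline\partial u\ge 0$ for every $u\in\mathcal P_\Gamma$. For a compact set $K\subset\mathbb C^k$ define the $\Gamma$-hull $$\widehat K_\Gamma:=\{z\in\mathbb C^k:\ u(z)\le \sup_K u\ \text{ for every } u\in\mathcal P_\Gamma\}.$$ Then $$\widehat K_\Gamma=\Big(\bigcup_T \operatorname{supp}(T)\Big)\cup K,$$ where the union is taken over all positive $\Gamma$-directed currents $T$ of bidimension $(1,1)$ on $\mathbb C^k$ with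 compact support such that $i\partial\overline\partial T\le 0$ on $\mathbb C^k\setminus K$. -/

import Mathlib

open scoped ComplexOrder ContDiff Distributions Topology
open Filter

noncomputable section

namespace GammaHull

/-- The space `ℂ^k` with its Euclidean norm. A `(1,0)`-vector `∑ j, ξ j • ∂/∂z_j` at a point is
represented by its coordinate vector `ξ`, which is again an element of this space. -/
abbrev Ck (k : ℕ) : Type := EuclideanSpace ℂ (Fin k)

/-- The value at one point of a complex `(1,1)`-form: the matrix `A` stands for
`∑ j, ∑ l, A j l • (i dz_j ∧ d\bar z_l)`. -/
abbrev Form11 (k : ℕ) : Type := Fin k → Fin k → ℂ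

variable {k : ℕ}

/-- `⟨A, i ξ ∧ \bar ξ⟩ = ∑ j, ∑ l, A j l ξ_j \bar ξ_l` for a `(1,0)`-vector `ξ`. -/
def Form11.eval (A : Form11 k) (ξ : Ck k) : ℂ :=
  ∑ j, ∑ l, A j l * ξ j * (starRingEnd ℂ) (ξ l)

/-- The Wirtinger operator `∂/∂z_j = (∂/∂x_j - i ∂/∂y_j) / 2`. -/
def wirtinger (j : Fin k) (f : Ck k → ℂ) (z : Ck k) : ℂ :=
  (fderiv ℝ f z (EuclideanSpace.single j 1)
    - Complex.I * fderiv ℝ f z (EuclideanSpace.single j Complex.I)) / 2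

/-- The Wirtinger operator `∂/∂\bar z_l = (∂/∂x_l + i ∂/∂y_l) / 2`. -/
def wirtingerBar (l : Fin k) (f : Ck k → ℂ) (z : Ck k) : ℂ :=
  (fderiv ℝ f z (EuclideanSpace.single l 1)
    + Complex.I * fderiv ℝ f z (EuclideanSpace.single l Complex.I)) / 2

/-- The `(1,1)`-form `i∂\bar∂u = ∑ j, ∑ l, (∂²u/∂z_j∂\bar z_l) i dz_j ∧ d\bar z_l`
of a real-valued function `u`. -/
def iddbar (u : Ck k → ℝ) (z : Ck k) : Form11 k :=
  fun j l => wirtinger j (wirtingerBar l (fun w => (u w : ℂ))) z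

/-- The cone `P_Γ` of `C²` functions `u` on `ℂ^k` with `⟨i∂\bar∂u(z), i ξ ∧ \bar ξ⟩ ≥ 0`
for all `z` and all `ξ ∈ Γ_z`. -/
def PGamma (Γ : Ck k → Set (Ck k)) : Set (Ck k → ℝ) :=
  {u | ContDiff ℝ 2 u ∧ ∀ z, ∀ ξ ∈ Γ z, 0 ≤ (iddbar u z).eval ξ}

/-- The hull of `K` with respect to `P_Γ`. The supremum is taken in `[-∞, ∞]`. -/
def hull (Γ : Ck k → Set (Ck k)) (K : Set (Ck k)) : Set (Ck k) :=
  {z | ∀ u ∈ PGamma Γ, (u z : EReal) ≤ ⨆ w ∈ K, (u w : EReal)}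

/-- Smooth compactly supported `(1,1)`-forms on `ℂ^k`. -/
abbrev TestForm (k : ℕ) : Type := 𝓓((⊤ : TopologicalSpace.Opens (Ck k)), Form11 k)

/-- Smooth compactly supported real functions on `ℂ^k`. -/
abbrev TestFun (k : ℕ) : Type := 𝓓((⊤ : TopologicalSpace.Opens (Ck k)), ℝ)

/-- Currents of bidimension `(1,1)` on `ℂ^k`: continuous `ℂ`-linear forms on the space of smooth
compactly supported `(1,1)`-forms, with its usual inductive limit topology. -/
abbrev Current (k : ℕ) : Type := TestForm k →L[ℂ] ℂ

theorem contDiff_wirtinger (j : Fin k) {f : Ck k → ℂ} (hf : ContDiff ℝ ∞ f) :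
    ContDiff ℝ ∞ (wirtinger j f) := by
  have h : ContDiff ℝ ∞ (fderiv ℝ f) := hf.fderiv_right (by simp)
  unfold wirtinger
  fun_prop

theorem contDiff_wirtingerBar (j : Fin k) {f : Ck k → ℂ} (hf : ContDiff ℝ ∞ f) :
    ContDiff ℝ ∞ (wirtingerBar j f) := by
  have h : ContDiff ℝ ∞ (fderiv ℝ f) := hf.fderiv_right (by simp)
  unfold wirtingerBar
  fun_prop

theorem contDiff_iddbar {u : Ck k → ℝ} (hu : ContDiff ℝ ∞ u) : ContDiff ℝ ∞ (iddbar u) := by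
  rw [contDiff_pi]
  intro j
  rw [contDiff_pi]
  intro l
  exact contDiff_wirtinger j (contDiff_wirtingerBar l (Complex.ofRealCLM.contDiff.comp hu))

theorem tsupport_wirtinger_subset (j : Fin k) (f : Ck k → ℂ) :
    tsupport (wirtinger j f) ⊆ tsupport f := by
  refine (closure_mono fun z hz => ?_).trans (tsupport_fderiv_subset ℝ (f := f))
  intro h
  exact hz (by simp [wirtinger, h])

theorem tsupport_wirtingerBar_subset (j : Fin k) (f : Ck k → ℂ) :
    tsupport (wirtingerBar j f) ⊆ tsupport f := by
  refine (closure_mono fun z hz => ?_).trans (tsupport_fderiv_subset ℝ (f := f))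
  intro h
  exact hz (by simp [wirtingerBar, h])

theorem tsupport_iddbar_subset (u : Ck k → ℝ) : tsupport (iddbar u) ⊆ tsupport u := by
  refine closure_minimal (fun z hz => ?_) (isClosed_tsupport u)
  by_contra h
  refine hz (funext fun j => funext fun l => ?_)
  have h1 : tsupport (fun w => (u w : ℂ)) ⊆ tsupport u :=
    closure_mono fun w hw hw' => hw (by simp [hw'])
  have h2 : wirtinger j (wirtingerBar l (fun w => (u w : ℂ))) z = 0 :=
    image_eq_zero_of_notMem_tsupport fun hz' =>
      h (h1 (tsupport_wirtingerBar_subset l _ (tsupport_wirtinger_subset j _ hz')))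
  exact h2

/-- `i∂\bar∂χ` as a test form, for a test function `χ`. -/
def iddbarTest (χ : TestFun k) : TestForm k where
  toFun := iddbar χ
  contDiff' := contDiff_iddbar χ.contDiff
  hasCompactSupport' := χ.hasCompactSupport.mono' ((subset_tsupport _).trans
    (tsupport_iddbar_subset χ))
  tsupport_subset' := fun _ _ => trivial

namespace Current

/-- Positivity: `⟨T, φ⟩ ≥ 0` for every test form `φ` that is positive at each point. -/
def IsPositive (T : Current k) : Prop :=
  ∀ φ : TestForm k, (∀ z ξ, 0 ≤ (φ z).eval ξ) → 0 ≤ T φ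

/-- The support of a current: the complement of the largest open set on which it vanishes. -/
def supp (T : Current k) : Set (Ck k) := Distribution.dsupport (T : TestForm k → ℂ)

/-- `⟨T, ψ⟩ = c`, where `ψ` is a continuous `(1,1)`-form with compact support and `T` is a current
of order zero (for instance a positive one): the value of the extension of `T` by continuity, that
is, `⟨T, φ n⟩ → c` for all smooth `φ n → ψ` uniformly with supports in a fixed compact set. -/
def HasPairing (T : Current k) (ψ : Ck k → Form11 k) (c : ℂ) : Prop :=
  ∀ φ : ℕ → TestForm k, (∃ L : Set (Ck k), IsCompact L ∧ ∀ n, tsupport (φ n) ⊆ L) →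
    TendstoUniformly (fun n => (φ n : Ck k → Form11 k)) ψ atTop →
      Tendsto (fun n => T (φ n)) atTop (𝓝 c)

/-- `T ∧ i∂\bar∂u ≥ 0` as a measure: `⟨T, χ i∂\bar∂u⟩` exists and is nonnegative for every test
function `χ ≥ 0`. Here `u` is of class `C²`, so that `i∂\bar∂u` is only continuous. -/
def WedgeNonneg (T : Current k) (u : Ck k → ℝ) : Prop :=
  ∀ χ : TestFun k, (∀ z, 0 ≤ χ z) →
    ∃ c : ℂ, 0 ≤ c ∧ T.HasPairing (fun z => (χ z : ℝ) • iddbar u z) c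

/-- The cone of positive `Γ`-directed currents of bidimension `(1,1)`:
`T ≥ 0` and `T ∧ i∂\bar∂u ≥ 0` for every `u` in `P_Γ`. -/
def IsPositiveDirected (Γ : Ck k → Set (Ck k)) (T : Current k) : Prop :=
  T.IsPositive ∧ ∀ u ∈ PGamma Γ, T.WedgeNonneg u

/-- `i∂\bar∂T ≤ 0` on `U`: `⟨i∂\bar∂T, χ⟩ = ⟨T, i∂\bar∂χ⟩ ≤ 0` for every test function `χ ≥ 0`
with compact support in `U`. -/
def IddbarNonposOn (T : Current k) (U : Set (Ck k)) : Prop :=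
  ∀ χ : TestFun k, (∀ z, 0 ≤ χ z) → tsupport χ ⊆ U → T (iddbarTest χ) ≤ 0

end Current

end GammaHull

end

noncomputable section

namespace GammaHull

variable {k : ℕ}

/-! Supports lie in the hull by a maximum principle. Let `u` in `P_Γ` separate `z` from `K`. Adding
ε‖·‖², subtracting a constant and composing with `posCube` gives `v ≥ 0` in `P_Γ` that vanishes near
`K` and is strictly positive along nonzero vectors of `Γ` near `z`. As `T` has compact support, `⟨T,
i∂∂̄v⟩ ≤ 0`, while `T ∧ i∂∂̄v ≥ 0`; hence `T ∧ i∂∂̄v = 0` (`exists_tendsto_zero`). Strictness leaves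
room to subtract from `v` a small multiple of a cut-off `q` of ‖·‖² without leaving `P_Γ`. So `T ∧
i∂∂̄q ≤ 0`, and the positive current `T` has no mass near `z` (`notMem_supp`). Mollification handles
functions that are only `C²`.

The converse is duality. For `z₀` in the hull, send `u` to the pair of its Levi form on the unit
vectors of `Γ` over a large ball and `u z₀ - u` on `K`. No pair is strictly positive, since `u`
could then be altered far away into a member of `P_Γ` separating `z₀` from `K` (`notMem_hull`).
Hahn–Banach (`exists_positive_form`) yields positive functionals, in effect measures ν on the
vectors and σ on `K`, with `∫ levi u dν = ∫ u dσ - m u(z₀)` and `m = σ(K) > 0`. The current `T = ∫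
iξ∧ξ̄ dν` is positive and directed, and `i∂∂̄T = σ - m δ_{z₀}`. Off `K` this is nonpositive, and for
`z₀ ∉ K` it forces `z₀` into the support. -/

/-! ### The Levi form as a real quadratic form in the second derivative -/

/-- The `(1,1)`-form attached to a real bilinear form on `ℂ^k`; applied to the second derivative of
`u` it gives `i∂\bar∂u`. -/
def hessForm : (Ck k →L[ℝ] Ck k →L[ℝ] ℝ) →L[ℝ] Form11 k where
  toFun B := fun j l =>
    (((B (EuclideanSpace.single j 1) (EuclideanSpace.single l 1)
      + B (EuclideanSpace.single j Complex.I) (EuclideanSpace.single l Complex.I) : ℝ) : ℂ)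
    + Complex.I * ((B (EuclideanSpace.single j 1) (EuclideanSpace.single l Complex.I)
      - B (EuclideanSpace.single j Complex.I) (EuclideanSpace.single l 1) : ℝ) : ℂ)) / 4
  map_add' A B := by
    ext j l
    simp only [add_apply, Pi.add_apply]
    push_cast
    ring
  map_smul' c B := by
    ext j l
    simp only [smul_apply, Pi.smul_apply, smul_eq_mul, RingHom.id_apply,
      Complex.real_smul]
    push_cast
    ring
  cont := by fun_prop

/-- The second derivative, as a bilinear form. -/
def hess (u : Ck k → ℝ) (z : Ck k) : Ck k →L[ℝ] Ck k →L[ℝ] ℝ := fderiv ℝ (fderiv ℝ u) z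

/-- The Levi form of `u` at `z`, evaluated at `ξ`. -/
def levi (u : Ck k → ℝ) (z ξ : Ck k) : ℝ :=
  (hess u z ξ ξ + hess u z (Complex.I • ξ) (Complex.I • ξ)) / 4

theorem fderiv_ofReal_comp {u : Ck k → ℝ} (hu : Differentiable ℝ u) (z v : Ck k) :
    fderiv ℝ (fun w => (u w : ℂ)) z v = (fderiv ℝ u z v : ℂ) := by
  have h : HasFDerivAt (fun w => (u w : ℂ)) (Complex.ofRealCLM.comp (fderiv ℝ u z)) z :=
    Complex.ofRealCLM.hasFDerivAt.comp z (hu z).hasFDerivAt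
  rw [h.fderiv]
  rfl

theorem iddbar_eq_hessForm {u : Ck k → ℝ} (hu : ContDiff ℝ 2 u) (z : Ck k) :
    iddbar u z = hessForm (hess u z) := by
  have hd : Differentiable ℝ u := hu.differentiable (by norm_num)
  have hd' : Differentiable ℝ (fderiv ℝ u) :=
    (hu.fderiv_right (m := 1) (by norm_num)).differentiable (by norm_num)
  ext j l
  have h1 : wirtingerBar l (fun w => (u w : ℂ)) = fun w =>
      ((fderiv ℝ u w (EuclideanSpace.single l 1) : ℂ)
        + Complex.I * (fderiv ℝ u w (EuclideanSpace.single l Complex.I) : ℂ)) / 2 := by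
    funext w
    simp only [wirtingerBar, fderiv_ofReal_comp hd]
  have h2 (a : Ck k) : HasFDerivAt (fun w => (fderiv ℝ u w a : ℂ))
      (Complex.ofRealCLM.comp ((hess u z).flip a)) z :=
    Complex.ofRealCLM.hasFDerivAt.comp z
      (by simpa [hess] using (hd' z).hasFDerivAt.clm_apply (hasFDerivAt_const a z))
  have h3 : HasFDerivAt (wirtingerBar l (fun w => (u w : ℂ)))
      ((2 : ℂ)⁻¹ • ((Complex.ofRealCLM.comp ((hess u z).flip (EuclideanSpace.single l 1)))
        + Complex.I • (Complex.ofRealCLM.comp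
          ((hess u z).flip (EuclideanSpace.single l Complex.I))))) z := by
    rw [h1]
    have := ((h2 (EuclideanSpace.single l 1)).add
      ((h2 (EuclideanSpace.single l Complex.I)).const_smul Complex.I)).const_smul (2 : ℂ)⁻¹
    refine this.congr_of_eventuallyEq (Eventually.of_forall fun w => ?_)
    simp [div_eq_inv_mul]
  simp only [iddbar, wirtinger, h3.fderiv, hessForm]
  simp
  linear_combination (-(1 / 4 : ℂ) * (hess u z (EuclideanSpace.single j Complex.I)
    (EuclideanSpace.single l Complex.I) : ℂ)) * Complex.I_sq

theorem sum_re_im_single (ξ : Ck k) :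
    ∑ j, ((ξ j).re • EuclideanSpace.single j (1 : ℂ)
      + (ξ j).im • EuclideanSpace.single j Complex.I) = ξ := by
  ext i
  simp [Finset.sum_apply, Pi.single_apply, Finset.sum_add_distrib]

/-- Expanding `ξ` and `iξ` in the real basis `e j`, `f j = i e j` gives the right side as the real
part; the symmetry of `B` kills the imaginary part. -/
theorem eval_hessForm {B : Ck k →L[ℝ] Ck k →L[ℝ] ℝ} (hB : ∀ v w, B v w = B w v) (ξ : Ck k) :
    (hessForm B).eval ξ
      = (((B ξ ξ + B (Complex.I • ξ) (Complex.I • ξ)) / 4 : ℝ) : ℂ) := by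
  set e : Fin k → Ck k := fun j => EuclideanSpace.single j (1 : ℂ) with he
  set f : Fin k → Ck k := fun j => EuclideanSpace.single j Complex.I with hf
  have h1 : ξ = ∑ j, ((ξ j).re • e j + (ξ j).im • f j) := (sum_re_im_single ξ).symm
  have h2 : Complex.I • ξ = ∑ j, ((ξ j).re • f j - (ξ j).im • e j) := by
    rw [← sum_re_im_single (Complex.I • ξ)]
    refine Finset.sum_congr rfl fun j _ => ?_
    simp [he, hf]
    abel
  have h3 : B ξ ξ = ∑ j, ∑ l, B ((ξ j).re • e j + (ξ j).im • f j)
      ((ξ l).re • e l + (ξ l).im • f l) := by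
    conv_lhs => rw [h1]
    rw [map_sum, map_sum B]
    conv_rhs => rw [Finset.sum_comm]
    exact Finset.sum_congr rfl fun l _ => sum_apply _ _ _
  have h4 : B (Complex.I • ξ) (Complex.I • ξ) = ∑ j, ∑ l,
      B ((ξ j).re • f j - (ξ j).im • e j) ((ξ l).re • f l - (ξ l).im • e l) := by
    rw [h2, map_sum, map_sum B]
    conv_rhs => rw [Finset.sum_comm]
    exact Finset.sum_congr rfl fun l _ => sum_apply _ _ _
  have h5 (j l : Fin k) : hessForm B j l * ξ j * (starRingEnd ℂ) (ξ l) =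
      (((B ((ξ j).re • e j + (ξ j).im • f j) ((ξ l).re • e l + (ξ l).im • f l)
        + B ((ξ j).re • f j - (ξ j).im • e j) ((ξ l).re • f l - (ξ l).im • e l)) / 4 : ℝ) : ℂ)
      + Complex.I * ((((B (e j) (e l) + B (f j) (f l)) * ((ξ j).im * (ξ l).re - (ξ j).re * (ξ l).im)
        + (B (e j) (f l) - B (f j) (e l))
          * ((ξ j).re * (ξ l).re + (ξ j).im * (ξ l).im)) / 4 : ℝ) : ℂ) := by
    apply Complex.ext
    · simp [hessForm, he, hf]
      ring
    · simp [hessForm, he, hf]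
      ring
  have h6 : ∑ j, ∑ l, ((B (e j) (e l) + B (f j) (f l))
        * ((ξ j).im * (ξ l).re - (ξ j).re * (ξ l).im)
        + (B (e j) (f l) - B (f j) (e l)) * ((ξ j).re * (ξ l).re + (ξ j).im * (ξ l).im)) / 4
      = 0 := by
    -- The summand is antisymmetric in `j` and `l`, so the sum equals its own negative.
    refine self_eq_neg.mp ?_
    conv_lhs => rw [Finset.sum_comm]
    rw [← Finset.sum_neg_distrib]
    refine Finset.sum_congr rfl fun j _ => ?_
    rw [← Finset.sum_neg_distrib]
    refine Finset.sum_congr rfl fun l _ => ?_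
    rw [hB (e l) (e j), hB (f l) (f j), hB (e l) (f j), hB (f l) (e j)]
    ring
  unfold Form11.eval
  simp_rw [h5, Finset.sum_add_distrib, ← Finset.mul_sum, ← Complex.ofReal_sum]
  rw [h6, h3, h4]
  simp only [Complex.ofReal_zero, mul_zero, add_zero, add_div, Finset.sum_add_distrib,
    Finset.sum_div]

theorem hess_symm {u : Ck k → ℝ} (hu : ContDiff ℝ 2 u) (z v w : Ck k) :
    hess u z v w = hess u z w v :=
  (hu.contDiffAt.isSymmSndFDerivAt (by simp)) v w

theorem eval_iddbar {u : Ck k → ℝ} (hu : ContDiff ℝ 2 u) (z ξ : Ck k) :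
    (iddbar u z).eval ξ = (levi u z ξ : ℂ) := by
  rw [iddbar_eq_hessForm hu, eval_hessForm (hess_symm hu z), levi]

theorem mem_PGamma_iff {Γ : Ck k → Set (Ck k)} {u : Ck k → ℝ} :
    u ∈ PGamma Γ ↔ ContDiff ℝ 2 u ∧ ∀ z, ∀ ξ ∈ Γ z, 0 ≤ levi u z ξ := by
  refine and_congr_right fun hu => ?_
  simp_rw [eval_iddbar hu, Complex.zero_le_real]

theorem continuous_hess {u : Ck k → ℝ} (hu : ContDiff ℝ 2 u) : Continuous (hess u) :=
  (hu.fderiv_right (m := 1) (by norm_num)).continuous_fderiv (by norm_num)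

theorem continuous_iddbar {u : Ck k → ℝ} (hu : ContDiff ℝ 2 u) : Continuous (iddbar u) := by
  rw [funext (iddbar_eq_hessForm hu)]
  exact hessForm.continuous.comp (continuous_hess hu)

theorem continuous_levi {u : Ck k → ℝ} (hu : ContDiff ℝ 2 u) :
    Continuous fun p : Ck k × Ck k => levi u p.1 p.2 := by
  have h := continuous_hess hu
  unfold levi
  fun_prop

theorem hess_add {u v : Ck k → ℝ} (hu : ContDiff ℝ 2 u) (hv : ContDiff ℝ 2 v) (z : Ck k) :
    hess (u + v) z = hess u z + hess v z := by
  have h : fderiv ℝ (u + v) = fderiv ℝ u + fderiv ℝ v := by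
    funext w
    exact fderiv_add (hu.differentiable (by norm_num) w) (hv.differentiable (by norm_num) w)
  rw [hess, h]
  exact fderiv_add
    ((hu.fderiv_right (m := 1) (by norm_num)).differentiable (by norm_num) z)
    ((hv.fderiv_right (m := 1) (by norm_num)).differentiable (by norm_num) z)

theorem hess_const_smul (c : ℝ) (u : Ck k → ℝ) (z : Ck k) : hess (c • u) z = c • hess u z := by
  have h : fderiv ℝ (c • u) = c • fderiv ℝ u := by
    funext w
    exact congrFun (fderiv_const_smul_field (𝕜 := ℝ) (f := u) c) w
  rw [hess, h]
  exact congrFun (fderiv_const_smul_field (𝕜 := ℝ) (f := fderiv ℝ u) c) z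

theorem iddbar_add {u v : Ck k → ℝ} (hu : ContDiff ℝ 2 u) (hv : ContDiff ℝ 2 v) (z : Ck k) :
    iddbar (u + v) z = iddbar u z + iddbar v z := by
  have h : ContDiff ℝ 2 (u + v) := hu.add hv
  rw [iddbar_eq_hessForm hu, iddbar_eq_hessForm hv, iddbar_eq_hessForm h, hess_add hu hv, map_add]

theorem iddbar_const_smul (c : ℝ) {u : Ck k → ℝ} (hu : ContDiff ℝ 2 u) (z : Ck k) :
    iddbar (c • u) z = c • iddbar u z := by
  have h : ContDiff ℝ 2 (c • u) := hu.const_smul c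
  rw [iddbar_eq_hessForm hu, iddbar_eq_hessForm h, hess_const_smul, map_smul]

theorem levi_add {u v : Ck k → ℝ} (hu : ContDiff ℝ 2 u) (hv : ContDiff ℝ 2 v) (z ξ : Ck k) :
    levi (u + v) z ξ = levi u z ξ + levi v z ξ := by
  simp only [levi, hess_add hu hv, add_apply]
  ring

theorem levi_const_smul (c : ℝ) (u : Ck k → ℝ) (z ξ : Ck k) :
    levi (c • u) z ξ = c * levi u z ξ := by
  simp only [levi, hess_const_smul, smul_apply, smul_eq_mul]
  ring

theorem levi_smul_vec (u : Ck k → ℝ) (z ξ : Ck k) (t : ℝ) :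
    levi u z (t • ξ) = t ^ 2 * levi u z ξ := by
  simp only [levi, smul_comm Complex.I t ξ, map_smul, smul_apply, smul_eq_mul]
  ring

theorem hess_congr {u v : Ck k → ℝ} {z : Ck k} (h : u =ᶠ[𝓝 z] v) : hess u z = hess v z :=
  (h.fderiv (𝕜 := ℝ)).fderiv_eq

theorem levi_congr {u v : Ck k → ℝ} {z : Ck k} (h : u =ᶠ[𝓝 z] v) (ξ : Ck k) :
    levi u z ξ = levi v z ξ := by
  simp only [levi, hess_congr h]

theorem hess_comp {u : Ck k → ℝ} (hu : ContDiff ℝ 2 u) {h : ℝ → ℝ} (hh : ContDiff ℝ 2 h)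
    (z v w : Ck k) : hess (h ∘ u) z v w
      = deriv h (u z) * hess u z v w
        + deriv (deriv h) (u z) * fderiv ℝ u z v * fderiv ℝ u z w := by
  have hd : Differentiable ℝ u := hu.differentiable (by norm_num)
  have hd' : Differentiable ℝ (fderiv ℝ u) :=
    (hu.fderiv_right (m := 1) (by norm_num)).differentiable (by norm_num)
  have hh1 : Differentiable ℝ h := hh.differentiable (by norm_num)
  have hh2 : Differentiable ℝ (deriv h) :=
    ((contDiff_succ_iff_deriv (n := 1)).mp hh).2.2.differentiable (by norm_num)
  have h1 : fderiv ℝ (h ∘ u) = fun w => deriv h (u w) • fderiv ℝ u w := by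
    funext w
    exact ((hh1 (u w)).hasDerivAt.comp_hasFDerivAt w (hd w).hasFDerivAt).fderiv
  have h2 : HasFDerivAt (fun w => deriv h (u w)) (deriv (deriv h) (u z) • fderiv ℝ u z) z :=
    (hh2 (u z)).hasDerivAt.comp_hasFDerivAt z (hd z).hasFDerivAt
  have h3 : hess (h ∘ u) z = deriv h (u z) • hess u z
      + (deriv (deriv h) (u z) • fderiv ℝ u z).smulRight (fderiv ℝ u z) := by
    rw [hess, h1]
    exact (h2.smul (hd' z).hasFDerivAt).fderiv
  rw [h3]
  simp

theorem levi_comp {u : Ck k → ℝ} (hu : ContDiff ℝ 2 u) {h : ℝ → ℝ} (hh : ContDiff ℝ 2 h)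
    (z ξ : Ck k) : levi (h ∘ u) z ξ = deriv h (u z) * levi u z ξ
      + deriv (deriv h) (u z)
        * ((fderiv ℝ u z ξ) ^ 2 + (fderiv ℝ u z (Complex.I • ξ)) ^ 2) / 4 := by
  simp only [levi, hess_comp hu hh]
  ring

theorem contDiff_normSq {n : ℕ∞ω} : ContDiff ℝ n fun z : Ck k => ‖z‖ ^ 2 :=
  contDiff_norm_sq ℝ

theorem levi_normSq (z ξ : Ck k) : levi (fun z => ‖z‖ ^ 2) z ξ = ‖ξ‖ ^ 2 := by
  have h1 : fderiv ℝ (fun z : Ck k => ‖z‖ ^ 2) = fun z => (2 : ℝ) • innerSL ℝ z := by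
    funext w
    rw [(hasStrictFDerivAt_norm_sq w).hasFDerivAt.fderiv]
    ext v
    simp [two_smul]
  have h2 : HasFDerivAt (fun z : Ck k => (2 : ℝ) • innerSL ℝ z) ((2 : ℝ) • innerSL ℝ) z :=
    ((innerSL ℝ (E := Ck k)).hasFDerivAt (x := z)).const_smul (2 : ℝ)
  have h3 : hess (fun z : Ck k => ‖z‖ ^ 2) z = (2 : ℝ) • innerSL ℝ := by
    rw [hess, h1]
    exact h2.fderiv
  have h4 (v : Ck k) : hess (fun z : Ck k => ‖z‖ ^ 2) z v v = 2 * ‖v‖ ^ 2 := by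
    rw [h3, ← real_inner_self_eq_norm_sq]
    rfl
  rw [levi, h4, h4, norm_smul, Complex.norm_I]
  ring

theorem norm_hess_apply_le (u : Ck k → ℝ) (z v : Ck k) :
    |hess u z v v| ≤ ‖hess u z‖ * ‖v‖ ^ 2 := by
  rw [← Real.norm_eq_abs, pow_two, ← mul_assoc]
  exact ContinuousLinearMap.le_opNorm₂ (hess u z) v v

theorem abs_levi_le (u : Ck k → ℝ) (z ξ : Ck k) : |levi u z ξ| ≤ ‖hess u z‖ * ‖ξ‖ ^ 2 := by
  have h1 := norm_hess_apply_le u z ξ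
  have h2 := norm_hess_apply_le u z (Complex.I • ξ)
  rw [norm_smul, Complex.norm_I, one_mul] at h2
  have h3 : 0 ≤ ‖hess u z‖ * ‖ξ‖ ^ 2 := by positivity
  generalize ‖hess u z‖ * ‖ξ‖ ^ 2 = c at *
  unfold levi
  rw [abs_le] at h1 h2 ⊢
  constructor <;> linarith [h1.1, h1.2, h2.1, h2.2]

theorem exists_norm_fderiv_fderiv_le {E : Type*} [NormedAddCommGroup E] [NormedSpace ℝ E]
    {f : E → ℝ} (hf : ContDiff ℝ 2 f) (hc : HasCompactSupport f) :
    ∃ C, ∀ z, ‖fderiv ℝ (fderiv ℝ f) z‖ ≤ C :=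
  ((hf.fderiv_right (m := 1) (by norm_num)).continuous_fderiv
    (by norm_num)).bounded_above_of_compact_support ((hc.fderiv ℝ).fderiv ℝ)

theorem exists_abs_levi_le {u : Ck k → ℝ} (hu : ContDiff ℝ 2 u) (hc : HasCompactSupport u) :
    ∃ C : ℝ, 0 ≤ C ∧ ∀ z ξ, |levi u z ξ| ≤ C * ‖ξ‖ ^ 2 := by
  obtain ⟨C, hC⟩ := exists_norm_fderiv_fderiv_le hu hc
  have hC0 : 0 ≤ ‖hess u 0‖ := by positivity
  refine ⟨C, hC0.trans (hC 0), fun z ξ => (abs_levi_le u z ξ).trans ?_⟩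
  gcongr
  exact hC z

/-! ### The cube of the positive part -/

/-- `t ↦ max(t, 0)³`: a convex increasing function of class `C²` vanishing on `(-∞, 0]`. -/
def posCube (t : ℝ) : ℝ := max t 0 ^ 3

/-- An exponent of at least 2 makes the power `o(s)` at the kink. The cases `n = 1` and `n = 0` give
the two derivatives of `posCube`. -/
theorem hasDerivAt_max_zero_pow (n : ℕ) (t : ℝ) :
    HasDerivAt (fun s : ℝ => max s 0 ^ (n + 2)) ((n + 2) * max t 0 ^ (n + 1)) t := by
  rcases lt_trichotomy t 0 with ht | rfl | ht
  · have h : (fun s : ℝ => max s 0 ^ (n + 2)) =ᶠ[𝓝 t] fun _ => 0 := by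
      filter_upwards [Iio_mem_nhds ht] with s hs
      simp [max_eq_right (le_of_lt (Set.mem_Iio.mp hs))]
    rw [max_eq_right ht.le]
    simpa using (hasDerivAt_const t (0 : ℝ)).congr_of_eventuallyEq h
  · rw [hasDerivAt_iff_isLittleO_nhds_zero]
    simp only [zero_add, max_self, ne_eq, Nat.add_eq_zero_iff, one_ne_zero, and_false,
      not_false_eq_true, zero_pow, mul_zero, smul_zero, sub_zero, OfNat.ofNat_ne_zero]
    have h1 : (fun s : ℝ => max s 0 ^ (n + 2)) =O[𝓝 0] fun s : ℝ => s ^ (n + 2) := by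
      refine Asymptotics.IsBigO.of_bound 1 (Eventually.of_forall fun s => ?_)
      rw [one_mul, norm_pow, norm_pow]
      gcongr
      rw [Real.norm_eq_abs, Real.norm_eq_abs, abs_of_nonneg (le_max_right _ _)]
      exact max_le (le_abs_self s) (abs_nonneg s)
    have h2 : (fun s : ℝ => s ^ (n + 2)) =o[𝓝 0] fun s : ℝ => s := by
      simpa using Asymptotics.isLittleO_pow_pow (𝕜 := ℝ) (show 1 < n + 2 by omega)
    exact h1.trans_isLittleO h2
  · have h : (fun s : ℝ => max s 0 ^ (n + 2)) =ᶠ[𝓝 t] fun s => s ^ (n + 2) := by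
      filter_upwards [Ioi_mem_nhds ht] with s hs
      simp [max_eq_left (le_of_lt (Set.mem_Ioi.mp hs))]
    rw [max_eq_left ht.le]
    have := (hasDerivAt_pow (n + 2) t).congr_of_eventuallyEq h
    simpa using this

theorem deriv_posCube : deriv posCube = fun t => 3 * max t 0 ^ 2 := by
  funext t
  have := (hasDerivAt_max_zero_pow 1 t).deriv
  norm_num at this
  exact this

theorem deriv_deriv_posCube : deriv (deriv posCube) = fun t => 6 * max t 0 := by
  rw [deriv_posCube]
  funext t
  have := ((hasDerivAt_max_zero_pow 0 t).const_mul (3 : ℝ)).deriv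
  norm_num at this
  rw [show (6 : ℝ) * max t 0 = 3 * (2 * max t 0) by ring]
  simpa using this

theorem contDiff_posCube : ContDiff ℝ 2 posCube := by
  have h1 : Differentiable ℝ posCube := fun t => (hasDerivAt_max_zero_pow 1 t).differentiableAt
  have h2 : Differentiable ℝ (deriv posCube) := by
    rw [deriv_posCube]
    exact fun t => ((hasDerivAt_max_zero_pow 0 t).const_mul (3 : ℝ)).differentiableAt
  rw [show (2 : ℕ∞ω) = 1 + 1 by norm_num, contDiff_succ_iff_deriv]
  refine ⟨h1, by simp, ?_⟩
  rw [contDiff_one_iff_deriv]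
  refine ⟨h2, ?_⟩
  rw [deriv_deriv_posCube]
  fun_prop

theorem posCube_nonneg (t : ℝ) : 0 ≤ posCube t := pow_nonneg (le_max_right _ _) _

theorem posCube_of_nonpos {t : ℝ} (ht : t ≤ 0) : posCube t = 0 := by
  simp [posCube, max_eq_right ht]

/-- Convexity makes the second-order term of the chain rule nonnegative, so truncation keeps a
quantitative lower bound where `u > 0`. -/
theorem le_levi_posCube_comp {u : Ck k → ℝ} (hu : ContDiff ℝ 2 u) (z ξ : Ck k) :
    3 * max (u z) 0 ^ 2 * levi u z ξ ≤ levi (posCube ∘ u) z ξ := by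
  rw [levi_comp hu contDiff_posCube, deriv_deriv_posCube, deriv_posCube]
  have : 0 ≤ max (u z) 0 := le_max_right _ _
  refine le_add_of_nonneg_right ?_
  positivity

/-! ### Mollification -/

section Mollification

open MeasureTheory ContinuousLinearMap
open scoped Convolution

variable {E F : Type*} [NormedAddCommGroup E] [NormedSpace ℝ E] [FiniteDimensional ℝ E]
  [MeasurableSpace E] [BorelSpace E] [NormedAddCommGroup F] [NormedSpace ℝ F]
  (μ : Measure E) [μ.IsAddHaarMeasure]

theorem tendstoUniformly_normed_convolution [CompleteSpace F] {φ : ℕ → ContDiffBump (0 : E)}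
    (hφ : Tendsto (fun n => (φ n).rOut) atTop (𝓝 0)) {f : E → F} (hf : Continuous f)
    (hc : HasCompactSupport f) :
    TendstoUniformly (fun n => (φ n).normed μ ⋆[lsmul ℝ ℝ, μ] f) f atTop := by
  have hu : UniformContinuous f := hc.uniformContinuous_of_continuous hf
  rw [Metric.tendstoUniformly_iff]
  intro ε hε
  obtain ⟨δ, hδ, h⟩ := Metric.uniformContinuous_iff.mp hu (ε / 2) (half_pos hε)
  filter_upwards [hφ.eventually_lt_const hδ] with n hn x
  rw [dist_comm]
  refine lt_of_le_of_lt ((φ n).dist_normed_convolution_le hf.aestronglyMeasurable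
    fun y hy => ?_) (half_lt_self hε)
  exact (h ((Metric.mem_ball.mp hy).trans hn)).le

theorem fderiv_normed_convolution (φ : ContDiffBump (0 : E)) {f : E → F} (hf : ContDiff ℝ 1 f)
    (hc : HasCompactSupport f) :
    fderiv ℝ (φ.normed μ ⋆[lsmul ℝ ℝ, μ] f) = φ.normed μ ⋆[lsmul ℝ ℝ, μ] fderiv ℝ f := by
  funext x
  exact (hc.hasFDerivAt_convolution_right (lsmul ℝ ℝ)
    (φ.contDiff_normed (n := 0)).continuous.locallyIntegrable hf x).fderiv

end Mollification

/-- Convolution with shrinking bumps commutes with derivatives, preserves sign and nearly preserves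
the zero set. It makes `C²` functions accessible to currents, which act on smooth forms. -/
theorem exists_mollification {E : Type*} [NormedAddCommGroup E] [NormedSpace ℝ E]
    [FiniteDimensional ℝ E] {G : Type*} [NormedAddCommGroup G] [NormedSpace ℝ G]
    (L : (E →L[ℝ] E →L[ℝ] ℝ) →L[ℝ] G) {f : E → ℝ} (hf : ContDiff ℝ 2 f)
    (hc : HasCompactSupport f) :
    ∃ g : ℕ → E → ℝ, (∀ n, ContDiff ℝ ∞ (g n)) ∧ ((∀ x, 0 ≤ f x) → ∀ n x, 0 ≤ g n x) ∧
      (∀ η > 0, ∀ᶠ n in atTop, ∀ x, (∀ y ∈ Metric.ball x η, f y = 0) → g n x = 0) ∧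
      TendstoUniformly (fun n z => L (fderiv ℝ (fderiv ℝ (g n)) z))
        (fun z => L (fderiv ℝ (fderiv ℝ f) z)) atTop := by
  let _ : MeasurableSpace E := borel E
  have _ : BorelSpace E := ⟨rfl⟩
  let μ : MeasureTheory.Measure E := MeasureTheory.Measure.addHaar
  let φ : ℕ → ContDiffBump (0 : E) := fun n =>
    ⟨1 / ((n : ℝ) + 1) / 2, 1 / ((n : ℝ) + 1), by positivity, half_lt_self (by positivity)⟩
  have hφ : Tendsto (fun n => (φ n).rOut) atTop (𝓝 0) := tendsto_one_div_add_atTop_nhds_zero_nat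
  have hf1 : ContDiff ℝ 1 f := hf.of_le (by norm_num)
  have hf' : ContDiff ℝ 1 (fderiv ℝ f) := hf.fderiv_right (by norm_num)
  refine ⟨fun n => MeasureTheory.convolution ((φ n).normed μ) f
    (ContinuousLinearMap.lsmul ℝ ℝ) μ, fun n => ?_, fun h n x => ?_, fun η hη => ?_, ?_⟩
  · exact (φ n).hasCompactSupport_normed.contDiff_convolution_left _ (φ n).contDiff_normed
      hf.continuous.locallyIntegrable
  · exact MeasureTheory.integral_nonneg fun y => mul_nonneg ((φ n).nonneg_normed y) (h _)
  · filter_upwards [hφ.eventually_lt_const hη] with n hn x hx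
    have hx0 : f x = 0 := hx x (Metric.mem_ball_self hη)
    rw [← hx0]
    refine (φ n).normed_convolution_eq_right fun y hy => ?_
    rw [hx0, hx y (Metric.ball_subset_ball hn.le hy)]
  · simp_rw [fderiv_normed_convolution μ _ hf1 hc,
      fderiv_normed_convolution μ _ hf' (hc.fderiv ℝ)]
    have hL : UniformContinuous L :=
      ContinuousLinearMap.uniformContinuous (E₁ := E →L[ℝ] E →L[ℝ] ℝ) (E₂ := G) L
    refine hL.comp_tendstoUniformly ?_
    exact tendstoUniformly_normed_convolution μ hφ (hf'.continuous_fderiv (by norm_num))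
      ((hc.fderiv ℝ).fderiv ℝ)

theorem exists_iddbar_mollification {f : Ck k → ℝ} (hf : ContDiff ℝ 2 f)
    (hc : HasCompactSupport f) :
    ∃ g : ℕ → Ck k → ℝ, (∀ n, ContDiff ℝ ∞ (g n)) ∧ ((∀ x, 0 ≤ f x) → ∀ n x, 0 ≤ g n x) ∧
      (∀ η > 0, ∀ᶠ n in atTop, ∀ x, (∀ y ∈ Metric.ball x η, f y = 0) → g n x = 0) ∧
      TendstoUniformly (fun n => iddbar (g n)) (iddbar f) atTop := by
  obtain ⟨g, h1, h2, h3, h4⟩ := exists_mollification hessForm hf hc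
  refine ⟨g, h1, h2, h3, ?_⟩
  rw [funext (iddbar_eq_hessForm hf)]
  simp_rw [fun n => funext (iddbar_eq_hessForm ((h1 n).of_le (by norm_cast)))]
  exact h4

/-! ### Cutoff functions and test forms -/

theorem exists_cutoff {C U : Set (Ck k)} (hC : IsCompact C) (hU : IsOpen U) (hCU : C ⊆ U) :
    ∃ χ : TestFun k, tsupport χ ⊆ U ∧ (∀ᶠ x in 𝓝ˢ C, χ x = 1) ∧ (∀ x, 0 ≤ χ x) ∧
      ∀ x, χ x ≤ 1 := by
  obtain ⟨L, hL, hCL, hLU⟩ := exists_compact_between hC hU hCU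
  obtain ⟨f, h1, h2, h3⟩ := exists_contMDiffMap_one_nhds_of_subset_interior
    (n := ⊤) (modelWithCornersSelf ℝ (Ck k)) hC.isClosed hCL
  have h4 : tsupport f ⊆ L :=
    closure_minimal (fun x hx => by_contra fun h => hx (h2 x h)) hL.isClosed
  exact ⟨⟨f, f.contMDiff.contDiff, hL.of_isClosed_subset (isClosed_tsupport _) h4,
    fun _ _ => trivial⟩, h4.trans hLU, h1, fun x => (h3 x).1, fun x => (h3 x).2⟩

/-- The test form `χ F`, for a test function `χ` and a smooth form `F`. -/
def mulForm (χ : TestFun k) (F : Ck k → Form11 k) (hF : ContDiff ℝ ∞ F) : TestForm k where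
  toFun := fun z => χ z • F z
  contDiff' := χ.contDiff.smul hF
  hasCompactSupport' := χ.hasCompactSupport.smul_right
  tsupport_subset' := fun _ _ => trivial

@[simp]
theorem mulForm_apply (χ : TestFun k) (F : Ck k → Form11 k) (hF : ContDiff ℝ ∞ F) (z : Ck k) :
    mulForm χ F hF z = χ z • F z :=
  rfl

theorem tsupport_mulForm_subset (χ : TestFun k) (F : Ck k → Form11 k) (hF : ContDiff ℝ ∞ F) :
    tsupport (mulForm χ F hF) ⊆ tsupport χ :=
  tsupport_smul_subset_left _ _

theorem disjoint_tsupport_of_eventually {X F : Type*} [TopologicalSpace X] [Zero F] {f : X → F}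
    {s : Set X} (h : ∀ᶠ x in 𝓝ˢ s, f x = 0) : tsupport f ⊆ sᶜ := by
  intro x hx hxs
  exact notMem_tsupport_iff_eventuallyEq.mpr
    (h.filter_mono (nhds_le_nhdsSet hxs)) hx

open Distribution in
-- A cutoff `χ` supported in `U` and equal to 1 near `tsupport φ \ V` splits `φ` into `χφ`,
-- supported in `U`, and `(1 - χ)φ`, supported in `V`.
theorem isVanishingOn_union {T : Current k} {U V : Set (Ck k)} (hU : IsOpen U) (hV : IsOpen V)
    (h1 : IsVanishingOn (T : TestForm k → ℂ) U) (h2 : IsVanishingOn (T : TestForm k → ℂ) V) :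
    IsVanishingOn (T : TestForm k → ℂ) (U ∪ V) := by
  intro φ hφ
  have hC : IsCompact (tsupport φ \ V) := φ.hasCompactSupport.diff hV
  obtain ⟨χ, hχ1, hχ2, -, -⟩ := exists_cutoff hC hU fun x hx => (hφ hx.1).resolve_right hx.2
  have h3 : T (mulForm χ φ φ.contDiff) = 0 :=
    h1 _ ((tsupport_mulForm_subset _ _ _).trans hχ1)
  have h4 : T (φ - mulForm χ φ φ.contDiff) = 0 := by
    refine h2 _ fun x hx => by_contra fun hxV => ?_
    have hx' : x ∈ tsupport φ := by
      refine closure_mono (Function.support_subset_iff'.mpr fun y hy => ?_) hx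
      simp [Function.notMem_support.mp hy]
    refine disjoint_tsupport_of_eventually (s := tsupport φ \ V) ?_ hx ⟨hx', hxV⟩
    filter_upwards [hχ2] with y hy
    simp [hy]
  rwa [map_sub, h3, sub_zero] at h4

open Distribution in
-- Each point off the support has a neighbourhood where `T` vanishes; compactness of `tsupport φ`
-- and gluing make this global.
theorem Current.apply_eq_zero {T : Current k} {φ : TestForm k} (h : tsupport φ ⊆ T.suppᶜ) :
    T φ = 0 := by
  have key : ∃ U, IsOpen U ∧ tsupport φ ⊆ U ∧ IsVanishingOn (T : TestForm k → ℂ) U := by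
    refine IsCompact.induction_on φ.hasCompactSupport
      (p := fun s => ∃ U, IsOpen U ∧ s ⊆ U ∧ IsVanishingOn (T : TestForm k → ℂ) U) ?_ ?_ ?_ ?_
    · refine ⟨∅, isOpen_empty, subset_rfl, fun ψ hψ => ?_⟩
      have : ψ = 0 := by
        ext1 x
        exact image_eq_zero_of_notMem_tsupport fun hx => hψ hx
      rw [this, map_zero]
    · rintro s t hst ⟨U, hU, htU, hT⟩
      exact ⟨U, hU, hst.trans htU, hT⟩
    · rintro s t ⟨U, hU, hsU, hTU⟩ ⟨V, hV, htV, hTV⟩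
      exact ⟨U ∪ V, hU.union hV, Set.union_subset_union hsU htV, isVanishingOn_union hU hV hTU hTV⟩
    · intro x hx
      obtain ⟨s, hs, hso, hxs⟩ := (notMem_dsupport_iff x).mp (h hx)
      exact ⟨s, mem_nhdsWithin_of_mem_nhds (hso.mem_nhds hxs), s, hso, subset_rfl, hs⟩
  obtain ⟨U, -, hU, hT⟩ := key
  exact hT φ hU

theorem Current.apply_congr {T : Current k} {φ ψ : TestForm k}
    (h : ∀ᶠ x in 𝓝ˢ T.supp, φ x = ψ x) : T φ = T ψ := by
  rw [← sub_eq_zero, ← map_sub]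
  refine Current.apply_eq_zero (disjoint_tsupport_of_eventually ?_)
  filter_upwards [h] with x hx
  simp [hx]

theorem contDiff_two_of_smooth {u : Ck k → ℝ} (hu : ContDiff ℝ ∞ u) : ContDiff ℝ 2 u :=
  hu.of_le (by norm_cast)

theorem iddbar_congr {u v : Ck k → ℝ} (hu : ContDiff ℝ 2 u) (hv : ContDiff ℝ 2 v) {z : Ck k}
    (h : u =ᶠ[𝓝 z] v) : iddbar u z = iddbar v z := by
  rw [iddbar_eq_hessForm hu, iddbar_eq_hessForm hv, hess_congr h]

/-- The test function `χ g`, for a test function `χ` and a smooth function `g`. -/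
def mulFun (χ : TestFun k) (g : Ck k → ℝ) (hg : ContDiff ℝ ∞ g) : TestFun k where
  toFun := fun z => χ z * g z
  contDiff' := χ.contDiff.mul hg
  hasCompactSupport' := χ.hasCompactSupport.mul_right
  tsupport_subset' := fun _ _ => trivial

@[simp]
theorem mulFun_apply (χ : TestFun k) (g : Ck k → ℝ) (hg : ContDiff ℝ ∞ g) (z : Ck k) :
    mulFun χ g hg z = χ z * g z :=
  rfl

/-- The test form `χ i∂\bar∂g`. -/
def mulIddbar (χ : TestFun k) (g : Ck k → ℝ) (hg : ContDiff ℝ ∞ g) : TestForm k :=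
  mulForm χ (iddbar g) (contDiff_iddbar hg)

@[simp]
theorem mulIddbar_apply (χ : TestFun k) (g : Ck k → ℝ) (hg : ContDiff ℝ ∞ g) (z : Ck k) :
    mulIddbar χ g hg z = χ z • iddbar g z :=
  rfl

theorem tendstoUniformly_smul_of_abs_le_one {X G : Type*} [NormedAddCommGroup G]
    [NormedSpace ℝ G] {χ : X → ℝ} (hχ : ∀ x, |χ x| ≤ 1) {f : ℕ → X → G} {g : X → G}
    (h : TendstoUniformly f g atTop) :
    TendstoUniformly (fun n x => χ x • f n x) (fun x => χ x • g x) atTop := by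
  rw [Metric.tendstoUniformly_iff] at h ⊢
  intro ε hε
  filter_upwards [h ε hε] with n hn x
  rw [dist_smul₀]
  exact (mul_le_of_le_one_left dist_nonneg (hχ x)).trans_lt (hn x)

/-! ### Vanishing of `T ∧ i∂∂̄v` -/

/-- If `i∂\bar∂T ≤ 0` on the open set where a nonnegative `v` in `P_Γ` lives, then
`T ∧ i∂\bar∂v = 0`. -/
theorem Current.IsPositiveDirected.exists_tendsto_zero {Γ : Ck k → Set (Ck k)} {K : Set (Ck k)}
    {T : Current k} (hT : T.IsPositiveDirected Γ) (hsupp : IsCompact T.supp)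
    (hdd : T.IddbarNonposOn Kᶜ) {v : Ck k → ℝ} (hv : v ∈ PGamma Γ) (hv0 : ∀ z, 0 ≤ v z)
    {η : ℝ} (hη : 0 < η) (hvK : ∀ z ∈ Metric.thickening η K, v z = 0)
    (χ : TestFun k) (hχ0 : ∀ z, 0 ≤ χ z) (hχ1 : ∀ z, χ z ≤ 1) :
    ∃ (g : ℕ → Ck k → ℝ) (hg : ∀ n, ContDiff ℝ ∞ (g n)),
      TendstoUniformly (fun n z => χ z • iddbar (g n) z) (fun z => χ z • iddbar v z) atTop ∧
      Tendsto (fun n => T (mulIddbar χ (g n) (hg n))) atTop (𝓝 0) := by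
  -- `χ₂` is 1 near `supp T` and dominates `χ`; `Θ` is 1 near `tsupport χ₂`, so `Θ v` can be
  -- mollified without changing `v` where it is tested.
  obtain ⟨χ₂, -, h1, h20, h21⟩ := exists_cutoff (hsupp.union χ.hasCompactSupport) isOpen_univ
    (Set.subset_univ _)
  obtain ⟨Θ, -, hΘ1, hΘ0, -⟩ := exists_cutoff χ₂.hasCompactSupport isOpen_univ
    (Set.subset_univ _)
  have hχ₂ (z : Ck k) (hz : z ∈ tsupport χ) : χ₂ z = 1 :=
    h1.self_of_nhdsSet z (Or.inr hz)
  have hle (z : Ck k) : χ z ≤ χ₂ z := by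
    by_cases hz : z ∈ tsupport χ
    · rw [hχ₂ z hz]
      exact hχ1 z
    · rw [image_eq_zero_of_notMem_tsupport hz]
      exact h20 z
  set f : Ck k → ℝ := fun z => Θ z * v z with hf_def
  have hf : ContDiff ℝ 2 f := (contDiff_two_of_smooth Θ.contDiff).mul hv.1
  have hfc : HasCompactSupport f := Θ.hasCompactSupport.mul_right
  have hfv (z : Ck k) (hz : z ∈ tsupport χ₂) : iddbar f z = iddbar v z := by
    refine iddbar_congr hf hv.1 ?_
    filter_upwards [hΘ1.filter_mono (nhds_le_nhdsSet hz)] with w hw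
    rw [hf_def]
    simp [hw]
  obtain ⟨g, hg, hg0, hgK, hgu⟩ := exists_iddbar_mollification hf hfc
  have hpair (χ' : TestFun k) (h0 : ∀ z, 0 ≤ χ' z) (hle' : ∀ z, χ' z ≤ χ₂ z) :
      TendstoUniformly (fun n z => χ' z • iddbar (g n) z) (fun z => χ' z • iddbar v z) atTop ∧
      ∃ c : ℂ, 0 ≤ c ∧ Tendsto (fun n => T (mulIddbar χ' (g n) (hg n))) atTop (𝓝 c) := by
    have hu : TendstoUniformly (fun n z => χ' z • iddbar (g n) z) (fun z => χ' z • iddbar v z)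
        atTop := by
      have := tendstoUniformly_smul_of_abs_le_one (χ := χ')
        (fun z => abs_le.mpr ⟨by linarith [h0 z], (hle' z).trans (h21 z)⟩) hgu
      convert! this using 2 with z
      by_cases hz : z ∈ tsupport χ₂
      · rw [hfv z hz]
      · have h2 := image_eq_zero_of_notMem_tsupport hz
        have h3 : χ' z = 0 := le_antisymm (h2 ▸ hle' z) (h0 z)
        rw [h3, zero_smul, zero_smul]
    refine ⟨hu, ?_⟩
    obtain ⟨c, hc, hp⟩ := hT.2 v hv χ' h0
    exact ⟨c, hc, hp _ ⟨tsupport χ', χ'.hasCompactSupport,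
      fun n => tsupport_mulForm_subset _ _ _⟩ hu⟩
  obtain ⟨hu, c, hc, hcT⟩ := hpair χ hχ0 hle
  obtain ⟨-, c', hc', hcT'⟩ := hpair (χ₂ - χ) (fun z => sub_nonneg.mpr (hle z))
    (fun z => sub_le_self _ (hχ0 z))
  -- Near `supp T` the cutoff is 1, so `T` does not distinguish `χ₂ i∂∂̄g` from `i∂∂̄(χ₂ g)`.
  have hsum (n : ℕ) : T (mulIddbar χ (g n) (hg n)) + T (mulIddbar (χ₂ - χ) (g n) (hg n))
      = T (iddbarTest (mulFun χ₂ (g n) (hg n))) := by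
    rw [← map_add]
    refine Current.apply_congr ?_
    have h2 : ∀ᶠ x in 𝓝ˢ T.supp, χ₂ x = 1 := h1.filter_mono
      (nhdsSet_mono Set.subset_union_left)
    filter_upwards [h2.eventually_nhdsSet] with z hz
    have h3 : iddbar (mulFun χ₂ (g n) (hg n)) z = iddbar (g n) z := by
      refine iddbar_congr (contDiff_two_of_smooth (mulFun χ₂ (g n) (hg n)).contDiff)
        (contDiff_two_of_smooth (hg n)) ?_
      filter_upwards [hz] with w hw
      simp [hw]
    change χ z • iddbar (g n) z + (χ₂ z - χ z) • iddbar (g n) z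
      = iddbar (mulFun χ₂ (g n) (hg n)) z
    rw [h3, ← add_smul, hz.self_of_nhds]
    simp
  have hle0 : c + c' ≤ 0 := by
    refine le_of_tendsto (hcT.add hcT') ?_
    -- Mollifying at scale below `η / 2` keeps the `η / 2`-neighbourhood of `K` in the zero set, so
    -- the test function is supported off `K`.
    filter_upwards [hgK (η / 2) (half_pos hη)] with n hn
    rw [hsum]
    refine hdd _ (fun z => mul_nonneg (h20 z)
      (hg0 (fun x => mul_nonneg (hΘ0 x) (hv0 x)) n z)) ?_
    refine disjoint_tsupport_of_eventually ?_
    filter_upwards [Metric.thickening_mem_nhdsSet K (half_pos hη)] with x hx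
    rw [mulFun_apply, hn x, mul_zero]
    intro y hy
    have : y ∈ Metric.thickening η K := by
      rw [Metric.mem_thickening_iff] at hx ⊢
      obtain ⟨w, hw, hxw⟩ := hx
      exact ⟨w, hw, by linarith [dist_triangle y x w, Metric.mem_ball.mp hy]⟩
    rw [hf_def]
    simp [hvK y this]
  have hc0 : c = 0 := le_antisymm ((le_add_of_nonneg_right hc').trans hle0) hc
  exact ⟨g, hg, hu, hc0 ▸ hcT⟩

/-! ### Vanishing of positive currents -/

theorem Form11.eval_add (A B : Form11 k) (ξ : Ck k) : (A + B).eval ξ = A.eval ξ + B.eval ξ := by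
  simp [Form11.eval, Finset.sum_add_distrib, add_mul]

theorem Form11.eval_smul (c : ℂ) (A : Form11 k) (ξ : Ck k) : (c • A).eval ξ = c * A.eval ξ := by
  simp [Form11.eval, Finset.mul_sum, mul_assoc]

theorem Form11.eval_real_smul (c : ℝ) (A : Form11 k) (ξ : Ck k) :
    (c • A).eval ξ = c * A.eval ξ := by
  simp [Form11.eval, Finset.mul_sum, mul_assoc]

theorem Form11.norm_eval_le (A : Form11 k) (ξ : Ck k) :
    ‖A.eval ξ‖ ≤ (k ^ 2 * ‖A‖) * ‖ξ‖ ^ 2 := by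
  have h (j l : Fin k) : ‖A j l * ξ j * (starRingEnd ℂ) (ξ l)‖ ≤ ‖A‖ * ‖ξ‖ ^ 2 := by
    rw [norm_mul, norm_mul, RCLike.norm_conj, pow_two, mul_assoc]
    gcongr
    · exact (norm_le_pi_norm (A j) l).trans (norm_le_pi_norm A j)
    · exact PiLp.norm_apply_le ξ j
    · exact PiLp.norm_apply_le ξ l
  calc ‖A.eval ξ‖ ≤ ∑ j : Fin k, ∑ l : Fin k, ‖A‖ * ‖ξ‖ ^ 2 :=
        (norm_sum_le _ _).trans (Finset.sum_le_sum fun j _ =>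
          (norm_sum_le _ _).trans (Finset.sum_le_sum fun l _ => h j l))
    _ = (k ^ 2 * ‖A‖) * ‖ξ‖ ^ 2 := by
        simp
        ring

/-- The Hermitian part of a `(1,1)`-form. -/
def Form11.herm (A : Form11 k) : Form11 k := fun j l => (A j l + (starRingEnd ℂ) (A l j)) / 2

theorem Form11.eval_herm (A : Form11 k) (ξ : Ck k) : A.herm.eval ξ = ((A.eval ξ).re : ℂ) := by
  have h : ∑ j, ∑ l, (starRingEnd ℂ) (A l j) * ξ j * (starRingEnd ℂ) (ξ l)
      = (starRingEnd ℂ) (A.eval ξ) := by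
    rw [Finset.sum_comm, Form11.eval, map_sum]
    refine Finset.sum_congr rfl fun j _ => ?_
    rw [map_sum]
    refine Finset.sum_congr rfl fun l _ => ?_
    simp
    ring
  rw [Complex.re_eq_add_conj, ← h]
  simp only [Form11.eval, Form11.herm, add_div, add_mul, Finset.sum_add_distrib, Finset.sum_div]
  congr 1 <;>
  · refine Finset.sum_congr rfl fun j _ => Finset.sum_congr rfl fun l _ => ?_
    ring

theorem Form11.herm_add_I_smul_herm (A : Form11 k) :
    A.herm + Complex.I • Form11.herm (-Complex.I • A) = A := by
  ext j l
  simp [Form11.herm]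
  linear_combination (-(A j l) + (starRingEnd ℂ) (A l j)) / 2 * Complex.I_sq

/-- The Hermitian part of a test form. -/
def hermTest (φ : TestForm k) : TestForm k where
  toFun := fun z => (φ z).herm
  contDiff' := by
    have h (j l : Fin k) : ContDiff ℝ ∞ fun z => φ z j l :=
      contDiff_pi.mp (contDiff_pi.mp φ.contDiff j) l
    refine contDiff_pi.mpr fun j => contDiff_pi.mpr fun l => ?_
    exact ((h j l).add (Complex.conjCLE.contDiff.comp (h l j))).div_const 2
  hasCompactSupport' := φ.hasCompactSupport.comp_left (g := Form11.herm)
    (by ext j l; simp [Form11.herm])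
  tsupport_subset' := fun _ _ => trivial

/-- On `tsupport φ` the form `β` is the Euclidean one, so `k² C β ± hermTest φ` is positive. Since
`T β = 0`, both signs of `T (hermTest φ)` are nonnegative. -/
theorem Current.IsPositive.apply_hermTest_eq_zero {T : Current k} (hT : T.IsPositive)
    {β : TestForm k} (hβ : T β ≤ 0) (hβ0 : ∀ z ξ, 0 ≤ (β z).eval ξ) {φ : TestForm k}
    (hφ : ∀ z ∈ tsupport φ, ∀ ξ, (β z).eval ξ = (‖ξ‖ ^ 2 : ℝ)) : T (hermTest φ) = 0 := by
  have hβ1 : T β = 0 := le_antisymm hβ (hT β hβ0)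
  obtain ⟨C, hC⟩ := φ.continuous.bounded_above_of_compact_support φ.hasCompactSupport
  have key (s : ℝ) (hs : |s| = 1) : 0 ≤ T (((k ^ 2 * C : ℝ) : ℂ) • β + (s : ℂ) • hermTest φ) := by
    refine hT _ fun z ξ => ?_
    change 0 ≤ Form11.eval (((k ^ 2 * C : ℝ) : ℂ) • β z + (s : ℂ) • (φ z).herm) ξ
    rw [Form11.eval_add, Form11.eval_smul, Form11.eval_smul, Form11.eval_herm]
    by_cases hz : z ∈ tsupport φ
    · rw [hφ z hz ξ, ← Complex.ofReal_mul, ← Complex.ofReal_mul, ← Complex.ofReal_add,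
        Complex.zero_le_real]
      have h1 : |s * ((φ z).eval ξ).re| ≤ (k ^ 2 * C) * ‖ξ‖ ^ 2 := by
        rw [abs_mul, hs, one_mul]
        refine (Complex.abs_re_le_norm _).trans ((Form11.norm_eval_le _ _).trans ?_)
        gcongr
        exact hC z
      linarith [(abs_le.mp h1).1]
    · have hC0 : 0 ≤ C := (norm_nonneg _).trans (hC z)
      rw [image_eq_zero_of_notMem_tsupport hz]
      have h2 : Form11.eval (0 : Form11 k) ξ = 0 := by simp [Form11.eval]
      rw [h2]
      simp only [Complex.zero_re, Complex.ofReal_zero, mul_zero, add_zero]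
      exact mul_nonneg (Complex.zero_le_real.mpr (by positivity)) (hβ0 z ξ)
  have h1 := key 1 (by simp)
  have h2 := key (-1) (by simp)
  simp only [map_add, map_smul, hβ1, smul_zero, zero_add, Complex.ofReal_one, one_smul,
    Complex.ofReal_neg, neg_smul, map_neg] at h1 h2
  exact le_antisymm (neg_nonneg.mp h2) h1

theorem Current.IsPositive.apply_eq_zero {T : Current k} (hT : T.IsPositive)
    {β : TestForm k} (hβ : T β ≤ 0) (hβ0 : ∀ z ξ, 0 ≤ (β z).eval ξ) {φ : TestForm k}
    (hφ : ∀ z ∈ tsupport φ, ∀ ξ, (β z).eval ξ = (‖ξ‖ ^ 2 : ℝ)) : T φ = 0 := by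
  have h1 : φ = hermTest φ + Complex.I • hermTest (-Complex.I • φ) := by
    ext1 z
    exact ((φ z).herm_add_I_smul_herm).symm
  have h2 : tsupport (-Complex.I • φ) ⊆ tsupport φ :=
    closure_mono (Function.support_subset_iff'.mpr fun z hz => by
      simp [Function.notMem_support.mp hz])
  rw [h1, map_add, map_smul, hT.apply_hermTest_eq_zero hβ hβ0 hφ,
    hT.apply_hermTest_eq_zero hβ hβ0 fun z hz => hφ z (h2 hz)]
  simp

/-! ### Supports of directed currents lie in the hull -/

/-- The maximum principle: a positive directed current with compact support and `i∂\bar∂T ≤ 0`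
outside `K` does not charge a neighbourhood of a point separated from `K` by `P_Γ`. -/
theorem Current.IsPositiveDirected.notMem_supp {Γ : Ck k → Set (Ck k)} {K : Set (Ck k)}
    (hK : IsCompact K) {T : Current k} (hT : T.IsPositiveDirected Γ) (hsupp : IsCompact T.supp)
    (hdd : T.IddbarNonposOn Kᶜ) {u : Ck k → ℝ} (hu : u ∈ PGamma Γ) {z : Ck k} {c : ℝ}
    (hKc : ∀ w ∈ K, u w < c) (hcz : c < u z) : z ∉ T.supp := by
  obtain ⟨R, hR⟩ := hK.isBounded.exists_norm_le
  obtain ⟨hu2, huΓ⟩ := mem_PGamma_iff.mp hu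
  have hN : ContDiff ℝ 2 fun w : Ck k => ‖w‖ ^ 2 := contDiff_normSq
  -- With a third of the gap, `ε‖w‖² ≤ d` on `K` gives `p < 0` there, while `p z ≥ 2d > d`.
  set d := (u z - c) / 3 with hd
  have hd0 : 0 < d := by rw [hd]; linarith
  set ε := d / (R ^ 2 + 1) with hε
  have hε0 : 0 < ε := by positivity
  set p : Ck k → ℝ := u + ε • (fun w : Ck k => ‖w‖ ^ 2) + fun _ => -(c + d) with hp
  have hpw (w : Ck k) : p w = u w + ε * ‖w‖ ^ 2 - (c + d) := by
    simp [hp, sub_eq_add_neg]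
  have hεN : ContDiff ℝ 2 (ε • fun w : Ck k => ‖w‖ ^ 2) := hN.const_smul ε
  have huN : ContDiff ℝ 2 (u + ε • fun w : Ck k => ‖w‖ ^ 2) := hu2.add hεN
  have hp2 : ContDiff ℝ 2 p := huN.add contDiff_const
  have hpl (w ξ : Ck k) : levi p w ξ = levi u w ξ + ε * ‖ξ‖ ^ 2 := by
    have h0 : levi (fun _ : Ck k => -(c + d)) w ξ = 0 := by simp [levi, hess]
    rw [hp, levi_add huN contDiff_const, levi_add hu2 hεN, levi_const_smul,
      levi_normSq, h0, add_zero]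
  have hpK (w : Ck k) (hw : w ∈ K) : p w < 0 := by
    have h1 : ε * ‖w‖ ^ 2 ≤ ε * (R ^ 2 + 1) := by
      have := pow_le_pow_left₀ (norm_nonneg w) (hR w hw) 2
      gcongr
      linarith
    have h2 : ε * (R ^ 2 + 1) = d := by
      rw [hε]
      field_simp
    rw [hpw]
    linarith [hKc w hw]
  have hpz : d < p z := by
    have h1 : 0 ≤ ε * ‖z‖ ^ 2 := by positivity
    rw [hpw]
    linarith
  have hpc : Continuous p := hp2.continuous
  set v : Ck k → ℝ := posCube ∘ p with hv
  have hv2 : ContDiff ℝ 2 v := contDiff_posCube.comp hp2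
  have hvl (w ξ : Ck k) (hξ : ξ ∈ Γ w) : 3 * max (p w) 0 ^ 2 * (ε * ‖ξ‖ ^ 2) ≤ levi v w ξ := by
    refine le_trans ?_ (le_levi_posCube_comp hp2 w ξ)
    rw [hpl]
    gcongr
    linarith [huΓ w ξ hξ]
  have hvP : v ∈ PGamma Γ :=
    mem_PGamma_iff.mpr ⟨hv2, fun w ξ hξ => le_trans (by positivity) (hvl w ξ hξ)⟩
  obtain ⟨κ, hκU, hκ1, -, -⟩ := exists_cutoff (isCompact_singleton (x := z))
    (isOpen_lt continuous_const hpc) (Set.singleton_subset_iff.mpr hpz)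
  rw [nhdsSet_singleton] at hκ1
  obtain ⟨V, hκV, hV, hzV⟩ := eventually_nhds_iff.mp hκ1
  set q : TestFun k := mulFun κ (fun w => ‖w‖ ^ 2) contDiff_normSq with hq
  have hqs : ContDiff ℝ ∞ q := q.contDiff
  have hq2 : ContDiff ℝ 2 q := contDiff_two_of_smooth hqs
  have hqV (w ξ : Ck k) (hw : w ∈ V) : levi q w ξ = ‖ξ‖ ^ 2 := by
    rw [← levi_normSq w ξ]
    refine levi_congr ?_ ξ
    filter_upwards [hV.mem_nhds hw] with y hy
    simp [hq, hκV y hy]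
  obtain ⟨C, hC0, hC⟩ := exists_abs_levi_le hq2 q.hasCompactSupport
  -- Where `p > d`, which contains `tsupport κ`, the Levi form of `v` along `Γ` is at least
  -- `3d²ε‖ξ‖²`; this absorbs `δ levi q`. The `+ 1` guards against `C = 0`.
  set δ := 3 * d ^ 2 * ε / (C + 1) with hδ
  have hδ0 : 0 < δ := by positivity
  have hδC : δ * C ≤ 3 * d ^ 2 * ε := by
    rw [hδ, div_mul_eq_mul_div, div_le_iff₀ (by positivity)]
    have : 0 ≤ 3 * d ^ 2 * ε := by positivity
    nlinarith
  have hδq : ContDiff ℝ 2 ((-δ) • ⇑q) := hq2.const_smul (-δ)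
  have hv' : v + (-δ) • ⇑q ∈ PGamma Γ := by
    refine mem_PGamma_iff.mpr ⟨hv2.add hδq, fun w ξ hξ => ?_⟩
    rw [levi_add hv2 hδq, levi_const_smul]
    have h1 := hvl w ξ hξ
    by_cases hw : w ∈ tsupport κ
    · have h2 : d < max (p w) 0 := lt_max_of_lt_left (hκU hw)
      have h3 : 3 * d ^ 2 * (ε * ‖ξ‖ ^ 2) ≤ 3 * max (p w) 0 ^ 2 * (ε * ‖ξ‖ ^ 2) := by gcongr
      have h4 : δ * levi q w ξ ≤ δ * (C * ‖ξ‖ ^ 2) := by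
        gcongr
        exact (le_abs_self _).trans (hC w ξ)
      have h5 : δ * C * ‖ξ‖ ^ 2 ≤ 3 * d ^ 2 * ε * ‖ξ‖ ^ 2 := by gcongr
      linarith
    · have h2 : levi q w ξ = 0 := by
        have h3 : (q : Ck k → ℝ) =ᶠ[𝓝 w] fun _ => 0 := by
          filter_upwards [notMem_tsupport_iff_eventuallyEq.mp hw] with y hy
          simp [hq, hy]
        rw [levi_congr h3]
        simp [levi, hess]
      rw [h2, mul_zero, add_zero]
      exact le_trans (by positivity) h1
  obtain ⟨χ, hχV, hχ1, hχ0, hχle⟩ := exists_cutoff (isCompact_singleton (x := z)) hV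
    (Set.singleton_subset_iff.mpr hzV)
  rw [nhdsSet_singleton] at hχ1
  obtain ⟨η, hη, hηK⟩ := hK.exists_thickening_subset_open (isOpen_lt hpc continuous_const) hpK
  obtain ⟨g, hg, hgu, hgT⟩ := hT.exists_tendsto_zero hsupp hdd hvP
    (fun w => posCube_nonneg _) hη
    (fun w hw => posCube_of_nonpos (le_of_lt (show p w < 0 from hηK hw))) χ hχ0 hχle
  set β : TestForm k := mulIddbar χ q hqs with hβ
  have hβ0 (w ξ : Ck k) : (β w).eval ξ = (χ w * ‖ξ‖ ^ 2 : ℝ) := by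
    rw [hβ, mulIddbar_apply, Form11.eval_real_smul, eval_iddbar hq2, ← Complex.ofReal_mul]
    by_cases hw : w ∈ V
    · rw [hqV w ξ hw]
    · rw [image_eq_zero_of_notMem_tsupport fun h => hw (hχV h), zero_mul, zero_mul]
  have hTβ : T β ≤ 0 := by
    obtain ⟨e, he, heT⟩ := hT.2 _ hv' χ hχ0
    -- The sequence approximating `v`, shifted by the fixed form `δβ`, approximates `χ i∂∂̄(v -
    -- δq)`. Its limit is therefore both `e ≥ 0` and `-δ T β`.
    have h1 : Tendsto (fun n => T (mulIddbar χ (g n) (hg n) - (δ : ℂ) • β)) atTop (𝓝 e) := by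
      refine heT _ ⟨tsupport χ, χ.hasCompactSupport, fun n => ?_⟩ ?_
      · refine closure_mono (Function.support_subset_iff'.mpr fun w hw => ?_)
        simp [hβ, Function.notMem_support.mp hw]
      · have h2 (w : Ck k) : χ w • iddbar (v + (-δ) • ⇑q) w = χ w • iddbar v w - (δ : ℂ) • β w := by
          rw [iddbar_add hv2 hδq, iddbar_const_smul _ hq2, hβ, mulIddbar_apply,
            Complex.coe_smul, smul_add, neg_smul, smul_neg, smul_comm δ, sub_eq_add_neg]
        simp_rw [h2]
        rw [Metric.tendstoUniformly_iff] at hgu ⊢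
        intro r hr
        filter_upwards [hgu r hr] with n hn w
        have := hn w
        rw [← dist_sub_right _ _ ((δ : ℂ) • β w)] at this
        exact this
    have h2 : Tendsto (fun n => T (mulIddbar χ (g n) (hg n) - (δ : ℂ) • β)) atTop
        (𝓝 (0 - (δ : ℂ) • T β)) := by
      simp_rw [map_sub, map_smul]
      exact hgT.sub_const _
    rw [tendsto_nhds_unique h1 h2, zero_sub, neg_nonneg, smul_eq_mul] at he
    rw [Complex.le_def] at he ⊢
    simp only [Complex.re_ofReal_mul, Complex.zero_re, Complex.im_ofReal_mul, Complex.zero_im] at he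
    exact ⟨by simpa using nonpos_of_mul_nonpos_right he.1 hδ0,
      by simpa [hδ0.ne'] using he.2⟩
  obtain ⟨W, hWχ, hW, hzW⟩ := eventually_nhds_iff.mp hχ1
  refine (Distribution.notMem_dsupport_iff z).mpr ⟨W, fun φ hφ => ?_, hW, hzW⟩
  refine hT.1.apply_eq_zero hTβ (fun w ξ => ?_) (φ := φ) fun w hw ξ => ?_
  · rw [hβ0, Complex.zero_le_real]
    exact mul_nonneg (hχ0 w) (sq_nonneg _)
  · rw [hβ0, hWχ w (hφ hw), one_mul]

theorem supp_subset_hull {Γ : Ck k → Set (Ck k)} {K : Set (Ck k)}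
    (hK : IsCompact K) {T : Current k} (hT : T.IsPositiveDirected Γ) (hsupp : IsCompact T.supp)
    (hdd : T.IddbarNonposOn Kᶜ) : T.supp ⊆ hull Γ K := by
  intro z hz u hu
  by_contra hlt
  obtain ⟨c, hc1, hc2⟩ := EReal.lt_iff_exists_real_btwn.mp (not_le.mp hlt)
  refine hT.notMem_supp hK hsupp hdd hu (c := c) (fun w hw => ?_) (EReal.coe_lt_coe_iff.mp hc2) hz
  exact EReal.coe_lt_coe_iff.mp
    ((le_iSup₂ (f := fun w (_ : w ∈ K) => (u w : EReal)) w hw).trans_lt hc1)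

theorem subset_hull (Γ : Ck k → Set (Ck k)) (K : Set (Ck k)) : K ⊆ hull Γ K :=
  fun z hz u _ => le_iSup₂ (f := fun w (_ : w ∈ K) => (u w : EReal)) z hz

/-! ### Duality by Hahn–Banach -/

/-- A function which is strictly separated from `K` at `z₀` and whose Levi form is nonnegative along
`Γ` on a large ball suffices to show that `z₀` is not in the hull. -/
theorem notMem_hull {Γ : Ck k → Set (Ck k)} {K : Set (Ck k)} (hK : IsCompact K) {R : ℝ}
    (hR0 : 0 ≤ R) (hKR : ∀ w ∈ K, ‖w‖ ≤ R) {z₀ : Ck k} (hz₀ : ‖z₀‖ ≤ R) {u : Ck k → ℝ}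
    (hu : ContDiff ℝ 2 u) (hΓ : ∀ z, ‖z‖ ≤ R + 1 → ∀ ξ ∈ Γ z, 0 ≤ levi u z ξ)
    (hlt : ∀ w ∈ K, u w < u z₀) : z₀ ∉ hull Γ K := by
  obtain ⟨χ, -, hχ1, -, -⟩ := exists_cutoff (isCompact_closedBall (0 : Ck k) (R + 1)) isOpen_univ
    (Set.subset_univ _)
  set f : Ck k → ℝ := fun z => χ z * u z with hf
  have hf2 : ContDiff ℝ 2 f := (contDiff_two_of_smooth χ.contDiff).mul hu
  have hfu (z : Ck k) (hz : ‖z‖ ≤ R + 1) : f =ᶠ[𝓝 z] u := by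
    filter_upwards [hχ1.filter_mono (nhds_le_nhdsSet (mem_closedBall_zero_iff.mpr hz))] with w hw
    simp [hf, hw]
  obtain ⟨A, hA0, hA⟩ := exists_abs_levi_le hf2 χ.hasCompactSupport.mul_right
  -- `posCube ∘ p` vanishes on the ball of radius `R`. Beyond radius `R + 1` one has `p ≥ 1`, so `A`
  -- times it compensates the Levi form of the cut-off `f`, bounded by `A‖ξ‖²`.
  set p : Ck k → ℝ := (fun z => ‖z‖ ^ 2) + fun _ => -R ^ 2 with hp
  have hp2 : ContDiff ℝ 2 p := contDiff_normSq.add contDiff_const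
  have hpl (z ξ : Ck k) : levi p z ξ = ‖ξ‖ ^ 2 := by
    have h0 : levi (fun _ : Ck k => -R ^ 2) z ξ = 0 := by simp [levi, hess]
    rw [hp, levi_add contDiff_normSq contDiff_const, levi_normSq, h0, add_zero]
  set g : Ck k → ℝ := posCube ∘ p with hg
  have hg2 : ContDiff ℝ 2 g := contDiff_posCube.comp hp2
  have hgl (z ξ : Ck k) : 3 * max (p z) 0 ^ 2 * ‖ξ‖ ^ 2 ≤ levi g z ξ := by
    rw [← hpl z ξ]
    exact le_levi_posCube_comp hp2 z ξ
  have hAg : ContDiff ℝ 2 (A • g) := hg2.const_smul A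
  have hv : f + A • g ∈ PGamma Γ := by
    refine mem_PGamma_iff.mpr ⟨hf2.add hAg, fun z ξ hξ => ?_⟩
    rw [levi_add hf2 hAg, levi_const_smul]
    rcases le_or_gt ‖z‖ (R + 1) with hz | hz
    · rw [levi_congr (hfu z hz)]
      exact add_nonneg (hΓ z hz ξ hξ) (mul_nonneg hA0 (le_trans (by positivity) (hgl z ξ)))
    · have h1 : 1 ≤ max (p z) 0 := by
        refine le_max_of_le_left ?_
        simp only [hp, Pi.add_apply]
        nlinarith
      have h2 : 1 ≤ 3 * max (p z) 0 ^ 2 := by nlinarith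
      have h3 : A * ‖ξ‖ ^ 2 ≤ A * levi g z ξ := by
        gcongr
        exact le_trans (le_mul_of_one_le_left (sq_nonneg _) h2) (hgl z ξ)
      linarith [(abs_le.mp (hA z ξ)).1]
  have hvu (z : Ck k) (hz : ‖z‖ ≤ R) : (f + A • g) z = u z := by
    have h1 : g z = 0 := by
      refine posCube_of_nonpos ?_
      simp only [hp, Pi.add_apply]
      nlinarith [norm_nonneg z]
    simp [h1, (hfu z (by linarith)).self_of_nhds]
  intro hz
  have h1 := hz _ hv
  rw [hvu z₀ hz₀] at h1
  rcases K.eq_empty_or_nonempty with rfl | hne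
  · simp at h1
  · obtain ⟨w₀, hw₀, hmax⟩ := hK.exists_isMaxOn hne hu.continuous.continuousOn
    have h2 : ⨆ w ∈ K, (((f + A • g) w : ℝ) : EReal) ≤ (u w₀ : EReal) := by
      refine iSup₂_le fun w hw => ?_
      rw [hvu w (hKR w hw)]
      exact EReal.coe_le_coe_iff.mpr (hmax hw)
    exact absurd (EReal.coe_le_coe_iff.mp (h1.trans h2)) (not_le.mpr (hlt w₀ hw₀))

/-- A subspace of `C(X)`, for `X` compact, without strictly positive functions is annihilated by a
strictly positive linear form. -/
theorem exists_positive_form {X : Type*} [TopologicalSpace X] [CompactSpace X]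
    (M : Submodule ℝ C(X, ℝ)) (hM : ∀ f ∈ M, ¬ ∀ x, 0 < f x) :
    ∃ L : C(X, ℝ) →L[ℝ] ℝ, (∀ f ∈ M, L f = 0) ∧ (∀ f : C(X, ℝ), (∀ x, 0 < f x) → 0 < L f) ∧
      ∀ f : C(X, ℝ), (∀ x, 0 ≤ f x) → 0 ≤ L f := by
  have hconv : Convex ℝ {f : C(X, ℝ) | ∀ x, 0 < f x} := by
    intro f hf g hg a b ha hb hab x
    exact convex_Ioi (0 : ℝ) (hf x) (hg x) ha hb hab
  have hopen : IsOpen {f : C(X, ℝ) | ∀ x, 0 < f x} := by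
    have := ContinuousMap.isOpen_setOfPred_mapsTo (X := X) isCompact_univ (isOpen_Ioi (a := (0 : ℝ)))
    simpa [Set.MapsTo] using this
  obtain ⟨L, c, hL1, hL2⟩ := geometric_hahn_banach_open hconv hopen M.convex
    (Set.disjoint_left.mpr fun f hf hfM => hM f hfM hf)
  have hc : c ≤ 0 := by simpa using hL2 0 M.zero_mem
  have hM0 (f : C(X, ℝ)) (hf : f ∈ M) : L f = 0 := by
    by_contra hne
    -- A linear form bounded below on a subspace vanishes there: this multiple of `f` would have
    -- value `c - 1 < c`.
    have := hL2 (((c - 1) / L f) • f) (M.smul_mem _ hf)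
    rw [map_smul, smul_eq_mul, div_mul_cancel₀ _ hne] at this
    linarith
  have hpos (f : C(X, ℝ)) (hf : ∀ x, 0 < f x) : 0 < (-L) f := by
    have := hL1 f hf
    rw [neg_apply]
    linarith
  refine ⟨-L, fun f hf => by rw [neg_apply, hM0 f hf, neg_zero], hpos, fun f hf => ?_⟩
  -- A nonnegative function is a limit of the strictly positive `f + ε`.
  have h1 : Tendsto (fun ε : ℝ => (-L) (f + ε • (1 : C(X, ℝ)))) (𝓝[>] 0)
      (𝓝 ((-L) (f + (0 : ℝ) • (1 : C(X, ℝ))))) := by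
    refine Tendsto.mono_left (Continuous.tendsto ?_ 0) nhdsWithin_le_nhds
    fun_prop
  rw [zero_smul, add_zero] at h1
  refine ge_of_tendsto h1 ?_
  filter_upwards [self_mem_nhdsWithin] with ε hε
  refine (hpos _ fun x => ?_).le
  have : 0 < ε := hε
  have := hf x
  simp
  linarith

/-- The Levi form of a `C²` function, restricted to a set of `(1,0)`-vectors. -/
def leviOn (S : Set (Ck k × Ck k)) (u : Ck k → ℝ) (hu : ContDiff ℝ 2 u) : C(S, ℝ) :=
  ⟨fun s => levi u s.1.1 s.1.2, (continuous_levi hu).comp continuous_subtype_val⟩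

@[simp]
theorem leviOn_apply (S : Set (Ck k × Ck k)) (u : Ck k → ℝ) (hu : ContDiff ℝ 2 u) (s : S) :
    leviOn S u hu s = levi u s.1.1 s.1.2 :=
  rfl

/-- The compact set of unit vectors in `Γ` over a closed ball. -/
def unitBundle (Γ : Ck k → Set (Ck k)) (R : ℝ) : Set (Ck k × Ck k) :=
  {p | ‖p.1‖ ≤ R ∧ ‖p.2‖ = 1 ∧ p.2 ∈ Γ p.1}

theorem isCompact_unitBundle {Γ : Ck k → Set (Ck k)}
    (hΓ : IsClosed {p : Ck k × Ck k | p.2 ∈ Γ p.1}) (R : ℝ) : IsCompact (unitBundle Γ R) := by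
  have h : unitBundle Γ R = (Metric.closedBall 0 R ×ˢ Metric.sphere 0 1)
      ∩ {p : Ck k × Ck k | p.2 ∈ Γ p.1} := by
    ext p
    simp [unitBundle, and_assoc]
  rw [h]
  exact ((isCompact_closedBall _ _).prod (isCompact_sphere _ _)).inter_right hΓ

/-- Duality: a point of the hull outside `K` is the pole of a positive measure on the unit vectors
of `Γ`. -/
theorem exists_form_of_mem_hull {Γ : Ck k → Set (Ck k)}
    (hΓcone : ∀ z, ∀ ξ ∈ Γ z, ∀ t : ℝ, 0 < t → t • ξ ∈ Γ z)
    (hΓclosed : IsClosed {p : Ck k × Ck k | p.2 ∈ Γ p.1}) {K : Set (Ck k)} (hK : IsCompact K)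
    {z₀ : Ck k} (hz₀ : z₀ ∈ hull Γ K) :
    ∃ (R : ℝ) (L : C(unitBundle Γ R, ℝ) →L[ℝ] ℝ) (m : ℝ), 0 < m ∧
      (∀ f : C(unitBundle Γ R, ℝ), (∀ x, 0 ≤ f x) → 0 ≤ L f) ∧
      ∀ (u : Ck k → ℝ) (hu : ContDiff ℝ 2 u), (∀ w ∈ K, u w = 0) →
        L (leviOn (unitBundle Γ R) u hu) = -m * u z₀ := by
  obtain ⟨R, hR⟩ := (hK.union (isCompact_singleton (x := z₀))).isBounded.exists_norm_le
  have hR0 : 0 ≤ R := (norm_nonneg z₀).trans (hR z₀ (by simp))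
  have hKR (w : Ck k) (hw : w ∈ K) : ‖w‖ ≤ R := hR w (Or.inl hw)
  set S := unitBundle Γ (R + 1) with hS
  have : CompactSpace S := isCompact_iff_compactSpace.mp (isCompact_unitBundle hΓclosed _)
  have : CompactSpace K := isCompact_iff_compactSpace.mp hK
  let join (f : C(S, ℝ)) (g : C(K, ℝ)) : C(S ⊕ K, ℝ) :=
    ⟨Sum.elim f g, f.continuous.sumElim g.continuous⟩
  let sep (u : Ck k → ℝ) (hu : Continuous u) : C(K, ℝ) :=
    ⟨fun w => u z₀ - u w, continuous_const.sub (hu.comp continuous_subtype_val)⟩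
  let M : Submodule ℝ C(S ⊕ K, ℝ) :=
    { carrier := {f | ∃ (u : Ck k → ℝ) (hu : ContDiff ℝ 2 u),
        f = join (leviOn S u hu) (sep u hu.continuous)}
      zero_mem' := by
        refine ⟨0, contDiff_zero_fun, ?_⟩
        ext (s | w)
        · simp [join, levi, hess]
        · simp [join, sep]
      add_mem' := by
        rintro _ _ ⟨u, hu, rfl⟩ ⟨v, hv, rfl⟩
        refine ⟨u + v, hu.add hv, ?_⟩
        ext (s | w)
        · simp [join, levi_add hu hv]
        · simp [join, sep]
          ring
      smul_mem' := by
        rintro c _ ⟨u, hu, rfl⟩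
        refine ⟨c • u, hu.const_smul c, ?_⟩
        ext (s | w)
        · simp [join, levi_const_smul]
        · simp [join, sep]
          ring }
  have hM : ∀ f ∈ M, ¬ ∀ x, 0 < f x := by
    rintro _ ⟨u, hu, rfl⟩ hpos
    refine notMem_hull hK hR0 hKR (hR z₀ (by simp)) hu (fun z hz ξ hξ => ?_)
      (fun w hw => sub_pos.mp (hpos (Sum.inr ⟨w, hw⟩))) hz₀
    rcases eq_or_ne ξ 0 with rfl | hne
    · simp [levi]
    · have hn : 0 < ‖ξ‖ := norm_pos_iff.mpr hne
      have h1 : 0 < levi u z (‖ξ‖⁻¹ • ξ) :=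
        hpos (Sum.inl ⟨(z, ‖ξ‖⁻¹ • ξ), hz, by
          rw [norm_smul, norm_inv, norm_norm, inv_mul_cancel₀ hn.ne'],
          hΓcone z ξ hξ _ (inv_pos.mpr hn)⟩)
      rw [levi_smul_vec] at h1
      exact (pos_of_mul_pos_right h1 (by positivity)).le
  obtain ⟨L, hLM, hLpos, hLnn⟩ := exists_positive_form M hM
  let inl : C(S, ℝ) →L[ℝ] C(S ⊕ K, ℝ) := LinearMap.mkContinuous
    { toFun := fun f => join f 0
      map_add' := fun f g => by ext (s | w) <;> simp [join]
      map_smul' := fun c f => by ext (s | w) <;> simp [join] } 1 fun f => by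
    rw [one_mul]
    refine (ContinuousMap.norm_le _ (norm_nonneg _)).mpr ?_
    rintro (s | w)
    · exact f.norm_coe_le_norm s
    · simp [join]
  set m := L (join 0 1) with hm
  have hjoin (f : C(S, ℝ)) (g : C(K, ℝ)) : L (join f g) = L (join f 0) + L (join 0 g) := by
    rw [← map_add]
    congr 1
    ext (s | w) <;> simp [join]
  have hconst (c : ℝ) : L (join 0 (ContinuousMap.const K c)) = c * m := by
    rw [hm, ← smul_eq_mul, ← map_smul]
    congr 1
    ext (s | w) <;> simp [join]
  -- If the mass `m` on `K` were 0, constants on `K` could be added freely. The pair of ‖·‖² has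
  -- first entry 1 and becomes strictly positive after adding `R² + 1` on `K`, yet `L` would still
  -- give 0.
  have hm0 : 0 < m := by
    have h1 : 0 ≤ m := hLnn _ (by rintro (s | w) <;> simp [join])
    refine lt_of_le_of_ne h1 fun h0 => ?_
    have hN : ContDiff ℝ 2 fun z : Ck k => ‖z‖ ^ 2 := contDiff_normSq
    have h2 : L (join (leviOn S _ hN) (sep _ hN.continuous)) = 0 := hLM _ ⟨_, hN, rfl⟩
    have h3 := hLpos (join (leviOn S _ hN) (sep _ hN.continuous)
        + join 0 (ContinuousMap.const K (R ^ 2 + 1))) (by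
      rintro (s | w)
      · simp [join, levi_normSq, s.2.2.1]
      · have := pow_le_pow_left₀ (norm_nonneg w.1) (hKR w.1 w.2) 2
        have := sq_nonneg ‖z₀‖
        simp [join, sep]
        linarith)
    rw [map_add, h2, hconst, ← h0] at h3
    simp at h3
  refine ⟨R + 1, L.comp inl, m, hm0, fun f hf => ?_, fun u hu huK => ?_⟩
  · exact hLnn _ (by
      rintro (s | w)
      · exact hf s
      · exact le_rfl)
  · have h1 : L (join (leviOn S u hu) (sep u hu.continuous)) = 0 := hLM _ ⟨u, hu, rfl⟩
    have h2 : sep u hu.continuous = ContinuousMap.const K (u z₀) := by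
      ext w
      simp [sep, huK w.1 w.2]
    rw [hjoin, h2, hconst] at h1
    change L (join (leviOn S u hu) 0) = _
    linarith

/-! ### The current defined by a positive measure on a compact set of unit vectors -/

theorem Form11.continuous_eval {X : Type*} [TopologicalSpace X] {ψ : X → Form11 k}
    {ξ : X → Ck k} (hψ : Continuous ψ) (hξ : Continuous ξ) :
    Continuous fun x => (ψ x).eval (ξ x) := by
  unfold Form11.eval
  fun_prop

/-- The values of a continuous form on a set of `(1,0)`-vectors. -/
def evalOn (S : Set (Ck k × Ck k)) (ψ : Ck k → Form11 k) (hψ : Continuous ψ) : C(S, ℂ) :=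
  ⟨fun s => (ψ s.1.1).eval s.1.2, by
    have h : Continuous fun s : S => ψ s.1.1 := by fun_prop
    exact Form11.continuous_eval h (by fun_prop)⟩

@[simp]
theorem evalOn_apply (S : Set (Ck k × Ck k)) (ψ : Ck k → Form11 k) (hψ : Continuous ψ) (s : S) :
    evalOn S ψ hψ s = (ψ s.1.1).eval s.1.2 :=
  rfl

/-- The inclusion of the real continuous functions. -/
def ofRealMap {X : Type*} [TopologicalSpace X] (f : C(X, ℝ)) : C(X, ℂ) :=
  ⟨fun x => (f x : ℂ), Complex.continuous_ofReal.comp f.continuous⟩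

@[simp]
theorem ofRealMap_apply {X : Type*} [TopologicalSpace X] (f : C(X, ℝ)) (x : X) :
    ofRealMap f x = (f x : ℂ) :=
  rfl

/-- The complex linear extension of a real linear form on `C(X, ℝ)`. -/
def complexForm {X : Type*} [TopologicalSpace X] [CompactSpace X] (L : C(X, ℝ) →L[ℝ] ℝ) :
    C(X, ℂ) →L[ℂ] ℂ :=
  StrongDual.extendRCLike (𝕜 := ℂ) (L.comp (Complex.reCLM.compLeftContinuous ℝ X))

theorem complexForm_ofRealMap {X : Type*} [TopologicalSpace X] [CompactSpace X]
    (L : C(X, ℝ) →L[ℝ] ℝ) (f : C(X, ℝ)) : complexForm L (ofRealMap f) = (L f : ℂ) := by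
  have h1 : Complex.reCLM.compLeftContinuous ℝ X (ofRealMap f) = f := by
    ext x
    simp
  have h2 : Complex.reCLM.compLeftContinuous ℝ X (Complex.I • ofRealMap f) = 0 := by
    ext x
    simp
  simp [complexForm, StrongDual.extendRCLike_apply, h1, h2]

section currentOf

variable {S : Set (Ck k × Ck k)} [CompactSpace S] (hS : ∀ s ∈ S, ‖s.2‖ = 1)

/-- The restriction of bounded continuous forms to a compact set of unit vectors. -/
def evalCLM : BoundedContinuousFunction (Ck k) (Form11 k) →L[ℂ] C(S, ℂ) :=
  LinearMap.mkContinuous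
    { toFun := fun ψ => evalOn S ψ ψ.continuous
      map_add' := fun φ ψ => by
        ext s
        exact Form11.eval_add _ _ _
      map_smul' := fun c ψ => by
        ext s
        exact Form11.eval_smul _ _ _ } (k ^ 2) fun ψ => by
    refine (ContinuousMap.norm_le _ (by positivity)).mpr fun s => ?_
    refine (Form11.norm_eval_le _ _).trans ?_
    rw [hS _ s.2, one_pow, mul_one]
    gcongr
    exact ψ.norm_coe_le_norm _

/-- The current `φ ↦ ∫ ⟨φ(z), iξ ∧ \bar ξ⟩ dν(z, ξ)`, for a measure `ν` on a compact set of unit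
vectors. -/
def currentOf (L : C(S, ℝ) →L[ℝ] ℝ) : Current k :=
  (complexForm L).comp ((evalCLM hS).comp (TestFunction.toBoundedContinuousFunctionCLM ℂ))

variable (L : C(S, ℝ) →L[ℝ] ℝ)

theorem currentOf_apply (φ : TestForm k) :
    currentOf hS L φ = complexForm L (evalOn S φ φ.continuous) :=
  rfl

theorem currentOf_of_eval_eq {φ : TestForm k} {f : C(S, ℝ)}
    (h : ∀ s : S, (φ s.1.1).eval s.1.2 = f s) : currentOf hS L φ = (L f : ℂ) := by
  rw [currentOf_apply, ← complexForm_ofRealMap]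
  congr 1
  ext s
  exact h s

theorem currentOf_hasPairing {ψ : Ck k → Form11 k} (hψ : Continuous ψ) :
    (currentOf hS L).HasPairing ψ (complexForm L (evalOn S ψ hψ)) := by
  intro φ _ hφ
  simp_rw [currentOf_apply]
  refine ((complexForm L).continuous.tendsto _).comp ?_
  rw [Metric.tendsto_nhds]
  rw [Metric.tendstoUniformly_iff] at hφ
  intro ε hε
  filter_upwards [hφ (ε / (k ^ 2 + 1)) (by positivity)] with n hn
  rw [ContinuousMap.dist_lt_iff hε]
  intro s
  have h1 := Form11.norm_eval_le (φ n s.1.1 - ψ s.1.1) s.1.2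
  have h2 : (φ n s.1.1).eval s.1.2 - (ψ s.1.1).eval s.1.2
      = (φ n s.1.1 - ψ s.1.1).eval s.1.2 := by
    rw [sub_eq_iff_eq_add, ← Form11.eval_add, sub_add_cancel]
  have h3 := hn s.1.1
  rw [dist_comm, dist_eq_norm, lt_div_iff₀ (by positivity)] at h3
  rw [dist_eq_norm, evalOn_apply, evalOn_apply, h2]
  rw [hS _ s.2, one_pow, mul_one] at h1
  have h4 : 0 ≤ ‖φ n s.1.1 - ψ s.1.1‖ := norm_nonneg _
  linarith

variable {L} in
-- The functional integrates values on vectors of `Γ` only, where `χ levi u` is pointwise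
-- nonnegative for `u` in `P_Γ`.
theorem currentOf_isPositiveDirected (hL : ∀ f : C(S, ℝ), (∀ x, 0 ≤ f x) → 0 ≤ L f)
    {Γ : Ck k → Set (Ck k)} (hSΓ : ∀ s ∈ S, s.2 ∈ Γ s.1) :
    (currentOf hS L).IsPositiveDirected Γ := by
  refine ⟨fun φ hφ => ?_, fun u hu χ hχ => ?_⟩
  · let f : C(S, ℝ) := ⟨fun s => ((φ s.1.1).eval s.1.2).re,
      Complex.continuous_re.comp (evalOn S φ φ.continuous).continuous⟩
    rw [currentOf_of_eval_eq hS L (f := f) fun s =>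
      Complex.ext rfl (Complex.le_def.mp (hφ _ _)).2.symm, Complex.zero_le_real]
    exact hL f fun s => (Complex.le_def.mp (hφ _ _)).1
  · have hc : Continuous fun z => χ z • iddbar u z := χ.continuous.smul (continuous_iddbar hu.1)
    refine ⟨_, ?_, currentOf_hasPairing hS L hc⟩
    let f : C(S, ℝ) := ⟨fun s => χ s.1.1 * levi u s.1.1 s.1.2,
      (χ.continuous.comp (continuous_fst.comp continuous_subtype_val)).mul
        (leviOn S u hu.1).continuous⟩
    have h : evalOn S _ hc = ofRealMap f := by
      ext s
      simp [f, Form11.eval_real_smul, eval_iddbar hu.1]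
    rw [h, complexForm_ofRealMap, Complex.zero_le_real]
    exact hL f fun s => mul_nonneg (hχ _) ((mem_PGamma_iff.mp hu).2 _ _ (hSΓ _ s.2))

theorem currentOf_iddbarTest (χ : TestFun k) (hχ : ContDiff ℝ 2 χ) :
    currentOf hS L (iddbarTest χ) = (L (leviOn S χ hχ) : ℂ) :=
  currentOf_of_eval_eq hS L fun _ => eval_iddbar hχ _ _

theorem supp_currentOf_subset {A : Set (Ck k)} (hA : IsClosed A) (hSA : ∀ s ∈ S, s.1 ∈ A) :
    (currentOf hS L).supp ⊆ A := by
  intro z hz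
  by_contra hzA
  refine (Distribution.notMem_dsupport_iff z).mpr ⟨Aᶜ, fun φ hφ => ?_, hA.isOpen_compl, hzA⟩ hz
  rw [currentOf_of_eval_eq hS L (f := 0) fun s => ?_, map_zero, Complex.ofReal_zero]
  rw [image_eq_zero_of_notMem_tsupport fun h => hφ h (hSA _ s.2)]
  simp [Form11.eval]

end currentOf

/-- Off `K` the constructed current satisfies `i∂∂̄T = -m δ_{z₀}`. This gives the sign, and `T`
cannot vanish near `z₀` because a cutoff equal to 1 there is sent to `-m ≠ 0`. -/
theorem exists_current_of_mem_hull {Γ : Ck k → Set (Ck k)}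
    (hΓcone : ∀ z, ∀ ξ ∈ Γ z, ∀ t : ℝ, 0 < t → t • ξ ∈ Γ z)
    (hΓclosed : IsClosed {p : Ck k × Ck k | p.2 ∈ Γ p.1}) {K : Set (Ck k)} (hK : IsCompact K)
    {z₀ : Ck k} (hz₀ : z₀ ∈ hull Γ K) (hz₀K : z₀ ∉ K) :
    ∃ T : Current k, (T.IsPositiveDirected Γ ∧ IsCompact T.supp ∧ T.IddbarNonposOn Kᶜ) ∧
      z₀ ∈ T.supp := by
  obtain ⟨R, L, m, hm, hL, hLm⟩ := exists_form_of_mem_hull hΓcone hΓclosed hK hz₀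
  have : CompactSpace (unitBundle Γ R) :=
    isCompact_iff_compactSpace.mp (isCompact_unitBundle hΓclosed _)
  have hS : ∀ s ∈ unitBundle Γ R, ‖s.2‖ = 1 := fun s hs => hs.2.1
  have hdd (χ : TestFun k) (hχ : tsupport χ ⊆ Kᶜ) :
      currentOf hS L (iddbarTest χ) = ((-m * χ z₀ : ℝ) : ℂ) := by
    rw [currentOf_iddbarTest hS L χ (contDiff_two_of_smooth χ.contDiff), hLm]
    exact fun w hw => image_eq_zero_of_notMem_tsupport fun h => hχ h hw
  refine ⟨currentOf hS L, ⟨currentOf_isPositiveDirected hS hL fun s hs => hs.2.2, ?_, ?_⟩, ?_⟩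
  · exact (isCompact_closedBall (0 : Ck k) R).of_isClosed_subset Distribution.isClosed_dsupport
      (supp_currentOf_subset hS L Metric.isClosed_closedBall fun s hs =>
        mem_closedBall_zero_iff.mpr hs.1)
  · intro χ hχ0 hχ
    rw [hdd χ hχ, ← Complex.ofReal_zero, Complex.real_le_real]
    have := mul_nonneg hm.le (hχ0 z₀)
    linarith
  · by_contra hz
    obtain ⟨U, hUT, hU, hzU⟩ := (Distribution.notMem_dsupport_iff z₀).mp hz
    obtain ⟨χ, hχU, hχ1, -, -⟩ := exists_cutoff (isCompact_singleton (x := z₀))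
      (hU.inter hK.isClosed.isOpen_compl) (Set.singleton_subset_iff.mpr ⟨hzU, hz₀K⟩)
    rw [nhdsSet_singleton] at hχ1
    have h1 : currentOf hS L (iddbarTest χ) = 0 :=
      hUT _ ((tsupport_iddbar_subset χ).trans (hχU.trans Set.inter_subset_left))
    rw [hdd χ (hχU.trans Set.inter_subset_right), hχ1.self_of_nhds] at h1
    have h2 : -m * 1 = 0 := by exact_mod_cast h1
    linarith

end GammaHull

end

theorem corollary3p5 {k : ℕ} (Γ : GammaHull.Ck k → Set (GammaHull.Ck k))
    (hΓcone : ∀ z, ∀ ξ ∈ Γ z, ∀ t : ℝ, 0 < t → t • ξ ∈ Γ z)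
    (hΓne : ∀ z, ∃ ξ ∈ Γ z, ξ ≠ 0)
    (hΓclosed : IsClosed {p : GammaHull.Ck k × GammaHull.Ck k | p.2 ∈ Γ p.1})
    (K : Set (GammaHull.Ck k)) (hK : IsCompact K) :
    GammaHull.hull Γ K =
      (⋃ T ∈ {T : GammaHull.Current k | T.IsPositiveDirected Γ ∧ IsCompact T.supp ∧
        T.IddbarNonposOn Kᶜ}, T.supp) ∪ K := by
  refine Set.Subset.antisymm (fun z hz => ?_) ?_
  · by_cases hzK : z ∈ K
    · exact Or.inr hzK
    · obtain ⟨T, hT, hzT⟩ := GammaHull.exists_current_of_mem_hull hΓcone hΓclosed hK hz hzK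
      exact Or.inl (Set.mem_iUnion₂.mpr ⟨T, hT, hzT⟩)
  · refine Set.union_subset (Set.iUnion₂_subset fun T hT => ?_) (GammaHull.subset_hull Γ K)
    exact GammaHull.supp_subset_hull hK hT.1 hT.2.1 hT.2.2
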